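/- Fix $0<H<\frac12$, $0<T<\infty$ and $p\ge 1$, and write $\|f\|_\infty=\sup_{0\le t\le T}|f(t)|$. For $0<s<t$ put $$K_{H,1}(t,s)=c_H\,t^{H-\frac12}s^{\frac12-H}(t-s)^{H-\frac12},\qquad K_{H,2}(t,s)=c_H\left(\tfrac12-H\right)s^{\frac12-H}\int_s^t u^{H-\frac32}(u-s)^{H-\frac12}\,du,$$ where $c_H=\left(\frac{2H}{(1-2H)\,\beta(1-2H,\,H+\frac12)}\right)^{1/2}$ and $\beta$ is the Beta function, and for a path $f$ with $f(0)=0$ that is $\lambda'$-Hölder continuous on $[0,T]$ for some $\lambda'>\frac12-H$ put $$(\Lambda_Hf)(t)=\int_0^t[f(t)-f(s)]\,\partial_sK_{H,1}(t,s)\,ds-\int_0^t\partial_sK_{H,2}(t,s)f(s)\,ds,\qquad 0\le t\le T.$$ Let $B=(B(t))_{t\ge0}$ be a real standard Brownian motion and let $B_H$ be the fractional Brownian motion with Hurst exponent $H$ that it realizes, that is, $B_H=\Lambda_HB$ on $[0,T]$ almost surely. Let $(\epsilon_k)_{k\ge1}$ be a sequence of positive numbers with $\epsilon_k\downarrow0$.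 For each $k$ let $T^k_0=0$ and $$T^k_n=\inf\{t>T^k_{n-1}:\ |B(t)-B(T^k_{n-1})|=\epsilon_k\},\quad n\ge1,\qquad A^k(t)=\sum_{n\ge1}\big(B(T^k_n)-B(T^k_{n-1})\big)\mathbf 1_{\{T^k_n\le t\}},$$ let $\bar t_k=\max\{T^k_n: T^k_n\le t\}$ and $\bar t_k^{+}=\min\{T^k_n:\bar t_k<T^k_n\}\wedge T$, and define $$B^k_H(t)=\int_0^{\bar t_k}\partial_sK_{H,1}(\bar t_k,s)\big[A^k(\bar t_k)-A^k(\bar s_k^{+})\big]ds-\int_0^{\bar t_k}\partial_sK_{H,2}(\bar t_k,s)A^k(s)\,ds,\qquad 0\le t\le T.$$ Then for every pair $(\delta,\lambda)$ with $\max\{0,1-\frac{pH}2\}<\delta<1$ and $\frac{1-H}2<\lambda<\frac12+\frac{\delta-1}{p}$ there is a constant $C$, depending only on $p,\delta,H,T,\lambda$, such that $$\mathbb E\,\|B^k_H-B_H\|_\infty^p\le C\,\epsilon_k^{\,p(1-2\lambda)+2(\delta-1)}\qquad\text{for every }k\ge1.$$ -/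

import Mathlib

open MeasureTheory ProbabilityTheory Filter Topology
open scoped NNReal ENNReal

noncomputable section

namespace KnightFBM

/-- The normalizing constant `c_H = (2H / ((1 - 2H) β(1 - 2H, H + 1/2)))^{1/2}` of the Volterra
kernel of fractional Brownian motion, `0 < H < 1/2`, with `β(a, b) = Γ(a) Γ(b) / Γ(a + b)`. -/
def cH (H : ℝ) : ℝ :=
  Real.sqrt (2 * H /
    ((1 - 2 * H) * (Real.Gamma (1 - 2 * H) * Real.Gamma (H + 1 / 2) / Real.Gamma (3 / 2 - H))))

/-- The kernel `K_{H,1}(t,s)`, used for `0 < s < t`. -/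
def K₁ (H t s : ℝ) : ℝ :=
  cH H * t ^ (H - 1 / 2) * s ^ (1 / 2 - H) * (t - s) ^ (H - 1 / 2)

/-- The kernel `K_{H,2}(t,s)`, used for `0 < s < t`. -/
def K₂ (H t s : ℝ) : ℝ :=
  cH H * (1 / 2 - H) * s ^ (1 / 2 - H) *
    ∫ u in s..t, u ^ (H - 3 / 2) * (u - s) ^ (H - 1 / 2)

/-- `∂_s K_{H,1}(t,s)`. -/
def dK₁ (H t s : ℝ) : ℝ := deriv (fun r => K₁ H t r) s

/-- `∂_s K_{H,2}(t,s)`. -/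
def dK₂ (H t s : ℝ) : ℝ := deriv (fun r => K₂ H t r) s

/-- The operator `Λ_H` on paths:
`(Λ_H f)(t) = ∫_0^t [f(t) - f(s)] ∂_s K_{H,1}(t,s) ds - ∫_0^t ∂_s K_{H,2}(t,s) f(s) ds`. -/
def Lam (H : ℝ) (f : ℝ≥0 → ℝ) (t : ℝ≥0) : ℝ :=
  (∫ s in (0 : ℝ)..t, (f t - f s.toNNReal) * dK₁ H t s) -
    ∫ s in (0 : ℝ)..t, dK₂ H t s * f s.toNNReal

/-- The times `T_0 = 0`, `T_{n+1} = inf {t > T_n : |f t - f T_n| = ε}` of a path `f`, with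
`inf ∅ = ∞` (so every time after an infinite one is infinite). -/
def knightTime (f : ℝ≥0 → ℝ) (ε : ℝ) : ℕ → ℝ≥0∞
  | 0 => 0
  | n + 1 => ⨅ (t : ℝ≥0) (_ : knightTime f ε n < t ∧
      |f t - f (knightTime f ε n).toNNReal| = ε), (t : ℝ≥0∞)

open Classical in
/-- The embedded walk `A(t) = ∑_{n ≥ 1} (f(T_n) - f(T_{n-1})) 1_{T_n ≤ t}`. For a continuous path
and `ε > 0` the sum has only finitely many nonzero terms. -/
def knightWalk (f : ℝ≥0 → ℝ) (ε : ℝ) (t : ℝ≥0) : ℝ :=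
  ∑' n : ℕ, if knightTime f ε (n + 1) ≤ t then
    f (knightTime f ε (n + 1)).toNNReal - f (knightTime f ε n).toNNReal else 0

/-- `t̄ = max {T_n : T_n ≤ t}`. -/
def lastTime (f : ℝ≥0 → ℝ) (ε : ℝ) (t : ℝ≥0) : ℝ≥0 :=
  sSup {r : ℝ≥0 | r ≤ t ∧ ∃ n, knightTime f ε n = r}

/-- `t̄⁺ = min {T_n : t̄ < T_n} ∧ T`. -/
def nextTime (f : ℝ≥0 → ℝ) (ε : ℝ) (T t : ℝ≥0) : ℝ≥0 :=
  ((⨅ (n : ℕ) (_ : (lastTime f ε t : ℝ≥0∞) < knightTime f ε n), knightTime f ε n) ⊓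
    (T : ℝ≥0∞)).toNNReal

/-- The pure jump approximation along the path `f`:
`∫_0^{t̄} ∂_s K_{H,1}(t̄,s) [A(t̄) - A(s̄⁺)] ds - ∫_0^{t̄} ∂_s K_{H,2}(t̄,s) A(s) ds`. -/
def approx (H : ℝ) (T : ℝ≥0) (f : ℝ≥0 → ℝ) (ε : ℝ) (t : ℝ≥0) : ℝ :=
  (∫ s in (0 : ℝ)..lastTime f ε t, dK₁ H (lastTime f ε t) s *
      (knightWalk f ε (lastTime f ε t) - knightWalk f ε (nextTime f ε T s.toNNReal))) -
    ∫ s in (0 : ℝ)..lastTime f ε t, dK₂ H (lastTime f ε t) s * knightWalk f ε s.toNNReal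

/-- `‖f‖_∞ = sup_{0 ≤ t ≤ T} |f t|`, as an extended nonnegative real. -/
def supNorm (T : ℝ≥0) (f : ℝ≥0 → ℝ) : ℝ≥0∞ := ⨆ (t : ℝ≥0) (_ : t ≤ T), ‖f t‖ₑ

end KnightFBM

end

/-!
The derivative kernels are homogeneous, `∂ₛK(τ, τ v) = τ ^ (H - 3/2) ∂ₛK(1, v)`, so a path error
bounded by `c (τ - s) ^ b` (for `K_{H,1}`) or `c s ^ b` (for `K_{H,2}`) with `b > 1/2 - H`
integrates to at most a constant times `c τ ^ (H - 1/2 + b)`. The embedded walk stays within `2ε`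
of `B`; interpolating this with the `γ`-Hölder continuity of `B`, `γ < 1/2`, gives an error of
order `ε ^ η` at the time `t̄`. Since `Λ_H` maps `γ`-Hölder paths to Hölder paths of any order
below `γ - (1/2 - H)`, replacing `t̄` by `t` costs a power of the gap `t - t̄`.

A gap longer than `ε ^ κ` with `κ < 2` forces many independent increments of `B` to be smaller
than their standard deviation by a power of `ε`, which has probability `O(ε ^ N)` for every `N`.
On that event the crude bound coming from `t - t̄ ≤ T` suffices, by the Cauchy–Schwarz inequality
and the Kolmogorov–Chentsov moments of the Hölder constant.
-/

namespace KnightFBM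

/-! ### Integrals against a homogeneous kernel -/

section Homogeneous

variable {k κ w e : ℝ → ℝ} {τ α c : ℝ}

lemma integral_homogeneous_mul (hτ : 0 < τ)
    (hk : ∀ v ∈ Set.Ioo (0 : ℝ) 1, k (τ * v) = τ ^ α * κ v) :
    ∫ s in (0 : ℝ)..τ, k s * e s = τ ^ (α + 1) * ∫ v in (0 : ℝ)..1, κ v * e (τ * v) := by
  have hsub := intervalIntegral.smul_integral_comp_mul_left (a := 0) (b := 1)
    (f := fun s => k s * e s) τ
  simp only [mul_zero, mul_one] at hsub
  rw [← hsub, Real.rpow_add_one hτ.ne', smul_eq_mul, mul_comm (τ ^ α) τ, mul_assoc]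
  congr 1
  rw [← intervalIntegral.integral_const_mul]
  refine intervalIntegral.integral_congr_ae ?_
  filter_upwards [Measure.ae_ne volume (1 : ℝ)] with v hv1 hv
  rw [Set.uIoc_of_le zero_le_one] at hv
  rw [hk v ⟨hv.1, lt_of_le_of_ne hv.2 hv1⟩, mul_assoc]

lemma intervalIntegrable_mul_of_abs_le (hκ : Measurable κ) (he : Measurable e)
    (hw : IntervalIntegrable (fun v => κ v * w v) volume 0 1)
    (hew : ∀ v ∈ Set.Ioo (0 : ℝ) 1, |e v| ≤ c * w v) :
    IntervalIntegrable (fun v => κ v * e v) volume 0 1 := by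
  rw [intervalIntegrable_iff_integrableOn_Ioo_of_le zero_le_one] at hw ⊢
  refine (hw.const_mul c).mono (hκ.mul he).aestronglyMeasurable ?_
  filter_upwards [ae_restrict_mem measurableSet_Ioo] with v hv
  calc ‖κ v * e v‖ = ‖κ v‖ * |e v| := norm_mul _ _
    _ ≤ ‖κ v‖ * ‖c * w v‖ := by gcongr; exact (hew v hv).trans (le_abs_self _)
    _ = ‖c * (κ v * w v)‖ := by rw [← norm_mul, mul_left_comm]

lemma abs_integral_mul_le (hw : IntervalIntegrable (fun v => κ v * w v) volume 0 1)
    (hew : ∀ v ∈ Set.Ioo (0 : ℝ) 1, |e v| ≤ c * w v) (hc : 0 ≤ c) :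
    |∫ v in (0 : ℝ)..1, κ v * e v| ≤ c * ∫ v in (0 : ℝ)..1, |κ v * w v| := by
  rw [← intervalIntegral.integral_const_mul, ← Real.norm_eq_abs]
  refine intervalIntegral.norm_integral_le_of_norm_le zero_le_one ?_ (hw.abs.const_mul c)
  filter_upwards [Measure.ae_ne volume (1 : ℝ)] with v hv1 hv
  calc ‖κ v * e v‖ = |κ v| * |e v| := norm_mul _ _
    _ ≤ |κ v| * (c * |w v|) := by
        gcongr
        exact (hew v ⟨hv.1, lt_of_le_of_ne hv.2 hv1⟩).trans
          (mul_le_mul_of_nonneg_left (le_abs_self _) hc)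
    _ = c * |κ v * w v| := by rw [abs_mul, mul_left_comm]

lemma intervalIntegrable_homogeneous_mul (hτ : 0 < τ)
    (hk : ∀ v ∈ Set.Ioo (0 : ℝ) 1, k (τ * v) = τ ^ α * κ v) (hκ : Measurable κ)
    (he : Measurable e) (hw : IntervalIntegrable (fun v => κ v * w v) volume 0 1)
    (hew : ∀ v ∈ Set.Ioo (0 : ℝ) 1, |e (τ * v)| ≤ c * w v) :
    IntervalIntegrable (fun s => k s * e s) volume 0 τ := by
  have hunit : IntervalIntegrable (fun v => κ v * e (τ * v)) volume 0 1 :=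
    intervalIntegrable_mul_of_abs_le hκ (he.comp (measurable_const_mul τ)) hw hew
  have hscaled :
      IntervalIntegrable (fun v => (fun s => k s * e s) (τ * v)) volume (0 / τ) (τ / τ) := by
    rw [zero_div, div_self hτ.ne']
    rw [intervalIntegrable_iff_integrableOn_Ioo_of_le zero_le_one] at hunit ⊢
    refine (hunit.const_mul (τ ^ α)).congr ?_
    filter_upwards [ae_restrict_mem measurableSet_Ioo] with v hv
    rw [hk v hv, mul_assoc]
  exact (IntervalIntegrable.comp_mul_left_iff hτ.ne').1 hscaled

lemma abs_integral_homogeneous_mul_le (hτ : 0 < τ)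
    (hk : ∀ v ∈ Set.Ioo (0 : ℝ) 1, k (τ * v) = τ ^ α * κ v)
    (hw : IntervalIntegrable (fun v => κ v * w v) volume 0 1)
    (hew : ∀ v ∈ Set.Ioo (0 : ℝ) 1, |e (τ * v)| ≤ c * w v) (hc : 0 ≤ c) :
    |∫ s in (0 : ℝ)..τ, k s * e s| ≤ c * τ ^ (α + 1) * ∫ v in (0 : ℝ)..1, |κ v * w v| := by
  have hpos : 0 ≤ τ ^ (α + 1) := Real.rpow_nonneg hτ.le _
  rw [integral_homogeneous_mul hτ hk, abs_mul, abs_of_nonneg hpos, mul_comm c, mul_assoc]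
  exact mul_le_mul_of_nonneg_left (abs_integral_mul_le hw hew hc) hpos

lemma deriv_of_homogeneous (hτ : 0 < τ)
    (hk : ∀ v ∈ Set.Ioo (0 : ℝ) 1, k (τ * v) = τ ^ α * κ v) :
    ∀ v ∈ Set.Ioo (0 : ℝ) 1, deriv k (τ * v) = τ ^ (α - 1) * deriv κ v := by
  intro v hv
  have hderiv : deriv (fun r => k (τ * r)) v = τ ^ α * deriv κ v := by
    rw [← deriv_const_mul_field]
    refine Filter.EventuallyEq.deriv_eq ?_
    filter_upwards [isOpen_Ioo.mem_nhds hv] with r hr using hk r hr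
  rw [deriv_comp_mul_left, smul_eq_mul] at hderiv
  rw [Real.rpow_sub_one hτ.ne', div_mul_eq_mul_div, eq_div_iff hτ.ne', mul_comm, hderiv]

end Homogeneous

/-! ### The kernels -/

section Kernels

variable {H b t : ℝ}

lemma intervalIntegrable_rpow_mul_one_sub_rpow {p q : ℝ} (hp : -1 < p) (hq : -1 < q) :
    IntervalIntegrable (fun v : ℝ => v ^ p * (1 - v) ^ q) volume 0 1 := by
  have hbeta := Complex.betaIntegral_convergent (u := (p + 1 : ℝ)) (v := (q + 1 : ℝ))
    (by simpa using by linarith) (by simpa using by linarith)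
  rw [intervalIntegrable_iff_integrableOn_Ioo_of_le zero_le_one] at hbeta ⊢
  refine hbeta.re.congr ?_
  filter_upwards [ae_restrict_mem measurableSet_Ioo] with v hv
  have hleft : (v : ℂ) ^ (((p + 1 : ℝ) : ℂ) - 1) = ((v ^ p : ℝ) : ℂ) := by
    rw [Complex.ofReal_cpow hv.1.le]; push_cast; ring_nf
  have hright : (1 - (v : ℂ)) ^ (((q + 1 : ℝ) : ℂ) - 1) = (((1 - v) ^ q : ℝ) : ℂ) := by
    rw [Complex.ofReal_cpow (sub_nonneg.2 hv.2.le)]; push_cast; ring_nf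
  rw [hleft, hright, ← Complex.ofReal_mul, RCLike.re_eq_complex_re, Complex.ofReal_re]

lemma K₁_mul (ht : 0 < t) {v : ℝ} (hv : v ∈ Set.Ioo (0 : ℝ) 1) :
    K₁ H t (t * v) = t ^ (H - 1 / 2) * K₁ H 1 v := by
  have hcancel : t ^ (1 / 2 - H) * t ^ (H - 1 / 2) = 1 := by
    rw [← Real.rpow_add ht]; simp
  rw [K₁, K₁, show t - t * v = t * (1 - v) by ring, Real.mul_rpow ht.le hv.1.le,
    Real.mul_rpow ht.le (sub_nonneg.2 hv.2.le), Real.one_rpow]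
  linear_combination
    (cH H * t ^ (H - 1 / 2) * v ^ (1 / 2 - H) * (1 - v) ^ (H - 1 / 2)) * hcancel

lemma integral_K₂_mul {c s : ℝ} (hc : 0 < c) (hs : 0 < s) (hst : s ≤ t) :
    ∫ u in (c * s)..(c * t), u ^ (H - 3 / 2) * (u - c * s) ^ (H - 1 / 2) =
      c ^ (2 * H - 1) * ∫ u in s..t, u ^ (H - 3 / 2) * (u - s) ^ (H - 1 / 2) := by
  rw [← intervalIntegral.smul_integral_comp_mul_left, smul_eq_mul,
    ← intervalIntegral.integral_const_mul, ← intervalIntegral.integral_const_mul]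
  refine intervalIntegral.integral_congr fun u hu => ?_
  rw [Set.uIcc_of_le hst] at hu
  have hexp : c ^ (2 * H - 1) = c ^ (1 : ℝ) * c ^ (H - 3 / 2) * c ^ (H - 1 / 2) := by
    rw [← Real.rpow_add hc, ← Real.rpow_add hc]
    ring_nf
  rw [← mul_sub, Real.mul_rpow hc.le (hs.le.trans hu.1),
    Real.mul_rpow hc.le (sub_nonneg.2 hu.1), hexp, Real.rpow_one]
  ring

lemma K₂_mul (ht : 0 < t) {v : ℝ} (hv : v ∈ Set.Ioo (0 : ℝ) 1) :
    K₂ H t (t * v) = t ^ (H - 1 / 2) * K₂ H 1 v := by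
  have hint := integral_K₂_mul (H := H) ht hv.1 hv.2.le
  rw [mul_one] at hint
  have hexp : t ^ (1 / 2 - H) * t ^ (2 * H - 1) = t ^ (H - 1 / 2) := by
    rw [← Real.rpow_add ht]; ring_nf
  rw [K₂, K₂, hint, Real.mul_rpow ht.le hv.1.le, ← hexp]
  ring

lemma dK₁_mul (ht : 0 < t) :
    ∀ v ∈ Set.Ioo (0 : ℝ) 1, dK₁ H t (t * v) = t ^ (H - 3 / 2) * dK₁ H 1 v := by
  rw [show H - 3 / 2 = H - 1 / 2 - 1 by ring]
  exact deriv_of_homogeneous ht fun v hv => K₁_mul ht hv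

lemma dK₂_mul (ht : 0 < t) :
    ∀ v ∈ Set.Ioo (0 : ℝ) 1, dK₂ H t (t * v) = t ^ (H - 3 / 2) * dK₂ H 1 v := by
  rw [show H - 3 / 2 = H - 1 / 2 - 1 by ring]
  exact deriv_of_homogeneous ht fun v hv => K₂_mul ht hv

lemma measurable_dK₁ (H t : ℝ) : Measurable (dK₁ H t) := measurable_deriv _

lemma measurable_dK₂ (H t : ℝ) : Measurable (dK₂ H t) := measurable_deriv _

lemma dK₁_one {v : ℝ} (hv : v ∈ Set.Ioo (0 : ℝ) 1) :
    dK₁ H 1 v = cH H * (1 / 2 - H) * (v ^ (-1 / 2 - H) * (1 - v) ^ (H - 3 / 2)) := by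
  have hv1 : 0 < 1 - v := sub_pos.2 hv.2
  have hleft : HasDerivAt (fun r : ℝ => r ^ (1 / 2 - H))
      ((1 / 2 - H) * v ^ (1 / 2 - H - 1)) v :=
    Real.hasDerivAt_rpow_const (Or.inl hv.1.ne')
  have hright : HasDerivAt (fun r : ℝ => (1 - r) ^ (H - 1 / 2))
      (-1 * (H - 1 / 2) * (1 - v) ^ (H - 1 / 2 - 1)) v :=
    ((hasDerivAt_id v).const_sub 1).rpow_const (Or.inl hv1.ne')
  have hK₁ : HasDerivAt (fun r => K₁ H 1 r) _ v :=
    ((hleft.mul hright).const_mul (cH H)).congr_of_eventuallyEq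
      (.of_eq (by ext r; simp [K₁, mul_assoc]))
  have hexp : v ^ (1 / 2 - H) = v ^ (-1 / 2 - H) * v := by
    rw [← Real.rpow_add_one hv.1.ne']; ring_nf
  have hexp' : (1 - v) ^ (H - 1 / 2) = (1 - v) ^ (H - 3 / 2) * (1 - v) := by
    rw [← Real.rpow_add_one hv1.ne']; ring_nf
  rw [dK₁, hK₁.deriv, show 1 / 2 - H - 1 = -1 / 2 - H by ring,
    show H - 1 / 2 - 1 = H - 3 / 2 by ring, hexp, hexp']
  ring

lemma intervalIntegrable_dK₁_mul (hH : H < 1 / 2) (hb : 1 / 2 - H < b) :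
    IntervalIntegrable (fun v => dK₁ H 1 v * (1 - v) ^ b) volume 0 1 := by
  have hbeta := (intervalIntegrable_rpow_mul_one_sub_rpow (p := -1 / 2 - H) (q := H - 3 / 2 + b)
    (by linarith) (by linarith)).const_mul (cH H * (1 / 2 - H))
  rw [intervalIntegrable_iff_integrableOn_Ioo_of_le zero_le_one] at hbeta ⊢
  refine hbeta.congr ?_
  filter_upwards [ae_restrict_mem measurableSet_Ioo] with v hv
  rw [dK₁_one hv, Real.rpow_add (sub_pos.2 hv.2)]
  ring

/-- The integral `G x = ∫_1^x u^{H-3/2} (u-1)^{H-1/2} du`, bounded for `H < 1/2`: after the change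
of variable `u = s w` the kernel `K_{H,2}(1, s)` is a multiple of `s^{H-1/2} G(1/s)`. -/
noncomputable def tailK₂ (H x : ℝ) : ℝ := ∫ u in (1 : ℝ)..x, u ^ (H - 3 / 2) * (u - 1) ^ (H - 1 / 2)

lemma integrableOn_tailK₂ (hH0 : 0 < H) (hH : H < 1 / 2) :
    IntegrableOn (fun u : ℝ => u ^ (H - 3 / 2) * (u - 1) ^ (H - 1 / 2)) (Set.Ioi 1) := by
  have hm : Measurable (fun u : ℝ => u ^ (H - 3 / 2) * (u - 1) ^ (H - 1 / 2)) := by fun_prop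
  rw [← Set.Ioc_union_Ioi_eq_Ioi one_le_two]
  refine IntegrableOn.union ?_ ?_
  · have hnear : IntervalIntegrable (fun u : ℝ => (u - 1) ^ (H - 1 / 2)) volume 1 2 := by
      simpa [one_add_one_eq_two] using (intervalIntegral.intervalIntegrable_rpow' (a := 0)
        (b := 1) (r := H - 1 / 2) (by linarith)).comp_sub_right 1
    rw [intervalIntegrable_iff_integrableOn_Ioc_of_le one_le_two] at hnear
    refine Integrable.mono hnear hm.aestronglyMeasurable ?_
    filter_upwards [ae_restrict_mem measurableSet_Ioc] with u hu
    rw [norm_mul]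
    refine mul_le_of_le_one_left (norm_nonneg _) ?_
    rw [Real.norm_of_nonneg (Real.rpow_nonneg (zero_le_one.trans hu.1.le) _)]
    exact Real.rpow_le_one_of_one_le_of_nonpos hu.1.le (by linarith)
  · have hfar := integrableOn_Ioi_rpow_of_lt (a := H - 3 / 2) (by linarith) (zero_lt_two (α := ℝ))
    refine Integrable.mono hfar hm.aestronglyMeasurable ?_
    filter_upwards [ae_restrict_mem measurableSet_Ioi] with u hu
    rw [Set.mem_Ioi] at hu
    rw [norm_mul]
    refine mul_le_of_le_one_right (norm_nonneg _) ?_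
    rw [Real.norm_of_nonneg (Real.rpow_nonneg (by linarith) _)]
    exact Real.rpow_le_one_of_one_le_of_nonpos (by linarith) (by linarith)

lemma tailK₂_nonneg {x : ℝ} (hx : 1 ≤ x) : 0 ≤ tailK₂ H x :=
  intervalIntegral.integral_nonneg hx fun _ hu =>
    mul_nonneg (Real.rpow_nonneg (zero_le_one.trans hu.1) _)
      (Real.rpow_nonneg (sub_nonneg.2 hu.1) _)

lemma tailK₂_le {x : ℝ} (hH0 : 0 < H) (hH : H < 1 / 2) (hx : 1 ≤ x) :
    tailK₂ H x ≤ ∫ u in Set.Ioi (1 : ℝ), u ^ (H - 3 / 2) * (u - 1) ^ (H - 1 / 2) := by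
  rw [tailK₂, intervalIntegral.integral_of_le hx]
  refine setIntegral_mono_set (integrableOn_tailK₂ hH0 hH) ?_ Set.Ioc_subset_Ioi_self.eventuallyLE
  filter_upwards [ae_restrict_mem measurableSet_Ioi] with u hu
  exact mul_nonneg (Real.rpow_nonneg (zero_le_one.trans (le_of_lt hu)) _)
    (Real.rpow_nonneg (sub_nonneg.2 (le_of_lt hu)) _)

lemma hasDerivAt_tailK₂ {x : ℝ} (hH0 : 0 < H) (hH : H < 1 / 2) (hx : 1 < x) :
    HasDerivAt (tailK₂ H) (x ^ (H - 3 / 2) * (x - 1) ^ (H - 1 / 2)) x := by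
  have hm : Measurable (fun u : ℝ => u ^ (H - 3 / 2) * (u - 1) ^ (H - 1 / 2)) := by fun_prop
  refine intervalIntegral.integral_hasDerivAt_right ?_
    hm.stronglyMeasurable.stronglyMeasurableAtFilter ?_
  · rw [intervalIntegrable_iff_integrableOn_Ioc_of_le hx.le]
    exact (integrableOn_tailK₂ hH0 hH).mono_set Set.Ioc_subset_Ioi_self
  · exact (Real.continuousAt_rpow_const _ _ (Or.inl (by linarith))).mul
      ((continuousAt_id.sub continuousAt_const).rpow_const (Or.inl (sub_pos.2 hx).ne'))

lemma K₂_one {v : ℝ} (hv : v ∈ Set.Ioo (0 : ℝ) 1) :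
    K₂ H 1 v = cH H * (1 / 2 - H) * (v ^ (H - 1 / 2) * tailK₂ H v⁻¹) := by
  have hint := integral_K₂_mul (H := H) (t := v⁻¹) hv.1 one_pos ((one_le_inv₀ hv.1).2 hv.2.le)
  rw [mul_inv_cancel₀ hv.1.ne', mul_one] at hint
  have hexp : v ^ (1 / 2 - H) * v ^ (2 * H - 1) = v ^ (H - 1 / 2) := by
    rw [← Real.rpow_add hv.1]; ring_nf
  rw [K₂, hint, tailK₂, ← hexp]
  ring

lemma dK₂_one (hH0 : 0 < H) (hH : H < 1 / 2) {v : ℝ} (hv : v ∈ Set.Ioo (0 : ℝ) 1) :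
    dK₂ H 1 v = cH H * (1 / 2 - H) * ((H - 1 / 2) * v ^ (H - 3 / 2) * tailK₂ H v⁻¹ -
      v ^ (-1 / 2 - H) * (1 - v) ^ (H - 1 / 2)) := by
  have hpow : HasDerivAt (fun r : ℝ => r ^ (H - 1 / 2)) ((H - 1 / 2) * v ^ (H - 1 / 2 - 1)) v :=
    Real.hasDerivAt_rpow_const (Or.inl hv.1.ne')
  have htail := (hasDerivAt_tailK₂ hH0 hH ((one_lt_inv₀ hv.1).2 hv.2)).comp v
    (hasDerivAt_inv hv.1.ne')
  have hK₂ : HasDerivAt (fun r => K₂ H 1 r) _ v :=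
    ((hpow.mul htail).const_mul (cH H * (1 / 2 - H))).congr_of_eventuallyEq (by
      filter_upwards [isOpen_Ioo.mem_nhds hv] with r hr using K₂_one hr)
  have hinv : v⁻¹ - 1 = (1 - v) * v⁻¹ := by
    rw [sub_mul, one_mul, mul_inv_cancel₀ hv.1.ne']
  have hexp : v ^ (-1 / 2 - H) = v ^ (H - 1 / 2) * ((v ^ (H - 3 / 2))⁻¹ * (v ^ (H - 1 / 2))⁻¹ *
      (v ^ (2 : ℝ))⁻¹) := by
    rw [← Real.rpow_neg hv.1.le, ← Real.rpow_neg hv.1.le, ← Real.rpow_neg hv.1.le,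
      ← Real.rpow_add hv.1, ← Real.rpow_add hv.1, ← Real.rpow_add hv.1]
    ring_nf
  rw [dK₂, hK₂.deriv, hinv, Real.mul_rpow (sub_nonneg.2 hv.2.le) (inv_nonneg.2 hv.1.le),
    Real.inv_rpow hv.1.le, Real.inv_rpow hv.1.le, hexp,
    show H - 1 / 2 - 1 = H - 3 / 2 by ring, Real.rpow_two, Function.comp_apply]
  ring

lemma abs_dK₂_one_le (hH0 : 0 < H) (hH : H < 1 / 2) {v : ℝ} (hv : v ∈ Set.Ioo (0 : ℝ) 1) :
    |dK₂ H 1 v| ≤ cH H * (1 / 2 - H) * ((1 / 2 - H) * v ^ (H - 3 / 2) *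
        (∫ u in Set.Ioi (1 : ℝ), u ^ (H - 3 / 2) * (u - 1) ^ (H - 1 / 2)) +
      v ^ (-1 / 2 - H) * (1 - v) ^ (H - 1 / 2)) := by
  have hv' : 1 ≤ v⁻¹ := (one_le_inv₀ hv.1).2 hv.2.le
  have hcoef : 0 ≤ (1 / 2 - H) * v ^ (H - 3 / 2) :=
    mul_nonneg (sub_nonneg.2 hH.le) (Real.rpow_nonneg hv.1.le _)
  have htail0 := mul_nonneg hcoef (tailK₂_nonneg (H := H) hv')
  have htail := mul_le_mul_of_nonneg_left (tailK₂_le hH0 hH hv') hcoef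
  have hpow : 0 ≤ v ^ (-1 / 2 - H) * (1 - v) ^ (H - 1 / 2) :=
    mul_nonneg (Real.rpow_nonneg hv.1.le _) (Real.rpow_nonneg (sub_nonneg.2 hv.2.le) _)
  have hcH : 0 ≤ cH H * (1 / 2 - H) := mul_nonneg (Real.sqrt_nonneg _) (sub_nonneg.2 hH.le)
  rw [dK₂_one hH0 hH hv, abs_mul, abs_of_nonneg hcH]
  refine mul_le_mul_of_nonneg_left (abs_le.2 ⟨?_, ?_⟩) hcH <;> linarith

lemma intervalIntegrable_dK₂_mul (hH0 : 0 < H) (hH : H < 1 / 2) (hb : 1 / 2 - H < b) :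
    IntervalIntegrable (fun v => dK₂ H 1 v * v ^ b) volume 0 1 := by
  set I := ∫ u in Set.Ioi (1 : ℝ), u ^ (H - 3 / 2) * (u - 1) ^ (H - 1 / 2)
  have hpow := (intervalIntegral.intervalIntegrable_rpow' (a := 0) (b := 1)
    (r := H - 3 / 2 + b) (by linarith)).const_mul ((1 / 2 - H) * I)
  have hbeta := intervalIntegrable_rpow_mul_one_sub_rpow (p := -1 / 2 - H + b) (q := H - 1 / 2)
    (by linarith) (by linarith)
  have hdom := (hpow.add hbeta).const_mul (cH H * (1 / 2 - H))
  rw [intervalIntegrable_iff_integrableOn_Ioo_of_le zero_le_one] at hdom ⊢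
  refine Integrable.mono hdom ((measurable_dK₂ H 1).mul (by fun_prop)).aestronglyMeasurable ?_
  filter_upwards [ae_restrict_mem measurableSet_Ioo] with v hv
  have hvb : 0 ≤ v ^ b := Real.rpow_nonneg hv.1.le _
  refine le_trans ?_ (le_abs_self _)
  rw [Real.norm_eq_abs, abs_mul, abs_of_nonneg hvb, Real.rpow_add hv.1, Real.rpow_add hv.1]
  refine (mul_le_mul_of_nonneg_right (abs_dK₂_one_le hH0 hH hv) hvb).trans (le_of_eq ?_)
  ring

/-- The mass `∫_0^1 |∂_s K_{H,1}(1, v)| (1 - v)^b dv`, finite for `b > 1/2 - H`. -/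
noncomputable def mass₁ (H b : ℝ) : ℝ := ∫ v in (0 : ℝ)..1, |dK₁ H 1 v * (1 - v) ^ b|

/-- The mass `∫_0^1 |∂_s K_{H,2}(1, v)| v^b dv`, finite for `b > 1/2 - H`. -/
noncomputable def mass₂ (H b : ℝ) : ℝ := ∫ v in (0 : ℝ)..1, |dK₂ H 1 v * v ^ b|

lemma mass₁_nonneg (H b : ℝ) : 0 ≤ mass₁ H b :=
  intervalIntegral.integral_nonneg zero_le_one fun _ _ => abs_nonneg _

lemma mass₂_nonneg (H b : ℝ) : 0 ≤ mass₂ H b :=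
  intervalIntegral.integral_nonneg zero_le_one fun _ _ => abs_nonneg _

end Kernels

section WeightedBounds

variable {H b c τ : ℝ} {e : ℝ → ℝ}

lemma abs_comp_mul_le_one_sub_rpow (hτ : 0 < τ)
    (he : ∀ s ∈ Set.Ioo 0 τ, |e s| ≤ c * (τ - s) ^ b) :
    ∀ v ∈ Set.Ioo (0 : ℝ) 1, |e (τ * v)| ≤ c * τ ^ b * (1 - v) ^ b := by
  intro v hv
  have h := he (τ * v) ⟨mul_pos hτ hv.1, mul_lt_of_lt_one_right hτ hv.2⟩
  rwa [show τ - τ * v = τ * (1 - v) by ring, Real.mul_rpow hτ.le (sub_nonneg.2 hv.2.le),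
    ← mul_assoc] at h

lemma abs_comp_mul_le_rpow (hτ : 0 < τ) (he : ∀ s ∈ Set.Ioo 0 τ, |e s| ≤ c * s ^ b) :
    ∀ v ∈ Set.Ioo (0 : ℝ) 1, |e (τ * v)| ≤ c * τ ^ b * v ^ b := by
  intro v hv
  have h := he (τ * v) ⟨mul_pos hτ hv.1, mul_lt_of_lt_one_right hτ hv.2⟩
  rwa [Real.mul_rpow hτ.le hv.1.le, ← mul_assoc] at h

lemma intervalIntegrable_dK₁_mul_of_abs_le (hH : H < 1 / 2) (hb : 1 / 2 - H < b) (hτ : 0 < τ)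
    (hm : Measurable e) (he : ∀ s ∈ Set.Ioo 0 τ, |e s| ≤ c * (τ - s) ^ b) :
    IntervalIntegrable (fun s => dK₁ H τ s * e s) volume 0 τ :=
  intervalIntegrable_homogeneous_mul hτ (dK₁_mul hτ) (measurable_dK₁ H 1) hm
    (intervalIntegrable_dK₁_mul hH hb) (abs_comp_mul_le_one_sub_rpow hτ he)

lemma intervalIntegrable_dK₂_mul_of_abs_le (hH0 : 0 < H) (hH : H < 1 / 2) (hb : 1 / 2 - H < b)
    (hτ : 0 < τ) (hm : Measurable e) (he : ∀ s ∈ Set.Ioo 0 τ, |e s| ≤ c * s ^ b) :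
    IntervalIntegrable (fun s => dK₂ H τ s * e s) volume 0 τ :=
  intervalIntegrable_homogeneous_mul hτ (dK₂_mul hτ) (measurable_dK₂ H 1) hm
    (intervalIntegrable_dK₂_mul hH0 hH hb) (abs_comp_mul_le_rpow hτ he)

lemma abs_integral_dK₁_mul_le (hH : H < 1 / 2) (hb : 1 / 2 - H < b) (hτ : 0 < τ) (hc : 0 ≤ c)
    (he : ∀ s ∈ Set.Ioo 0 τ, |e s| ≤ c * (τ - s) ^ b) :
    |∫ s in (0 : ℝ)..τ, dK₁ H τ s * e s| ≤ c * τ ^ (b - (1 / 2 - H)) * mass₁ H b := by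
  refine (abs_integral_homogeneous_mul_le hτ (dK₁_mul hτ) (intervalIntegrable_dK₁_mul hH hb)
    (abs_comp_mul_le_one_sub_rpow hτ he) (mul_nonneg hc (Real.rpow_nonneg hτ.le _))).trans_eq ?_
  rw [mul_assoc c, ← Real.rpow_add hτ, mass₁]
  ring_nf

lemma abs_integral_dK₂_mul_le (hH0 : 0 < H) (hH : H < 1 / 2) (hb : 1 / 2 - H < b) (hτ : 0 < τ)
    (hc : 0 ≤ c) (he : ∀ s ∈ Set.Ioo 0 τ, |e s| ≤ c * s ^ b) :
    |∫ s in (0 : ℝ)..τ, dK₂ H τ s * e s| ≤ c * τ ^ (b - (1 / 2 - H)) * mass₂ H b := by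
  refine (abs_integral_homogeneous_mul_le hτ (dK₂_mul hτ) (intervalIntegrable_dK₂_mul hH0 hH hb)
    (abs_comp_mul_le_rpow hτ he) (mul_nonneg hc (Real.rpow_nonneg hτ.le _))).trans_eq ?_
  rw [mul_assoc c, ← Real.rpow_add hτ, mass₂]
  ring_nf

end WeightedBounds

/-! ### The operator `Λ_H` on Hölder paths -/

lemma le_rpow_mul_rpow {x X Y θ : ℝ} (hx : 0 ≤ x) (hX : x ≤ X) (hY : x ≤ Y) (h0 : 0 ≤ θ)
    (h1 : θ ≤ 1) : x ≤ X ^ (1 - θ) * Y ^ θ :=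
  calc x = x ^ (1 - θ) * x ^ θ := by rw [← Real.rpow_add' hx (by simp)]; simp
    _ ≤ X ^ (1 - θ) * Y ^ θ := by
        have : 0 ≤ 1 - θ := sub_nonneg.2 h1
        have : 0 ≤ X := hx.trans hX
        gcongr

lemma le_mul_rpow_mul_rpow {x A d e γ b : ℝ} (hx : 0 ≤ x) (hA : 0 ≤ A) (hd : 0 ≤ d) (he : 0 ≤ e)
    (hb : 0 ≤ b) (hbγ : b ≤ γ) (hγ : 0 < γ) (hxd : x ≤ A * d ^ γ) (hxe : x ≤ A * e ^ γ) :
    x ≤ A * d ^ (γ - b) * e ^ b := by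
  refine (le_rpow_mul_rpow hx hxd hxe (div_nonneg hb hγ.le) ((div_le_one hγ).2 hbγ)).trans_eq ?_
  have hAA : A ^ (1 - b / γ) * A ^ (b / γ) = A := by
    rw [← Real.rpow_add' hA (by simp)]; simp
  rw [Real.mul_rpow hA (Real.rpow_nonneg hd _), Real.mul_rpow hA (Real.rpow_nonneg he _),
    ← Real.rpow_mul hd, ← Real.rpow_mul he, mul_div_cancel₀ _ hγ.ne', mul_sub,
    mul_div_cancel₀ _ hγ.ne', mul_one]
  linear_combination (d ^ (γ - b) * e ^ b) * hAA

lemma abs_rpow_neg_sub_rpow_neg_mul_rpow_le {a γ r t : ℝ} (ha0 : 0 < a) (ha1 : a ≤ 1)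
    (haγ : a < γ) (hγ : γ ≤ 1) (hr : 0 < r) (hrt : r ≤ t) :
    |t ^ (-a) - r ^ (-a)| * r ^ γ ≤ (t - r) ^ (γ - a) := by
  have ht : 0 < t := hr.trans_le hrt
  have hanti : t ^ (-a) ≤ r ^ (-a) := Real.rpow_le_rpow_of_nonpos hr hrt (by linarith)
  have hq : 0 < r / t := div_pos hr ht
  have hq1 : r / t ≤ 1 := (div_le_one ht).2 hrt
  have hfactor : (r ^ (-a) - t ^ (-a)) * r ^ γ = r ^ (γ - a) * (1 - (r / t) ^ a) := by
    rw [Real.div_rpow hr.le ht.le, Real.rpow_sub hr, Real.rpow_neg hr.le, Real.rpow_neg ht.le]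
    have := (Real.rpow_pos_of_pos hr a).ne'
    have := (Real.rpow_pos_of_pos ht a).ne'
    field_simp
  have hratio : r / t ≤ (r / t) ^ a := by
    simpa using Real.rpow_le_rpow_of_exponent_ge hq hq1 ha1
  have hdefect : 1 - r / t ≤ (1 - r / t) ^ (γ - a) := by
    rcases (sub_nonneg.2 hq1).eq_or_lt with h | h
    · rw [← h]; exact Real.rpow_nonneg le_rfl _
    · simpa using Real.rpow_le_rpow_of_exponent_ge h (by linarith) (show γ - a ≤ 1 by linarith)
  rw [abs_sub_comm, abs_of_nonneg (sub_nonneg.2 hanti), hfactor,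
    show t - r = t * (1 - r / t) by field_simp, Real.mul_rpow ht.le (by linarith)]
  exact mul_le_mul (Real.rpow_le_rpow hr.le hrt (by linarith)) (by linarith)
    (sub_nonneg.2 (Real.rpow_le_one hq.le hq1 ha0.le)) (Real.rpow_nonneg ht.le _)

/-- The profile `Φ` of `Λ_H f`, for which `(Λ_H f)(t) = t^{H-1/2} Φ(t)`: the integrals defining
`Λ_H f` are taken over the fixed interval `[0, 1]`, by the substitution `s = t v`. -/
noncomputable def profile (H : ℝ) (f : ℝ≥0 → ℝ) (t : ℝ≥0) : ℝ :=
  (∫ v in (0 : ℝ)..1, dK₁ H 1 v * (f t - f (t * v).toNNReal)) -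
    ∫ v in (0 : ℝ)..1, dK₂ H 1 v * f (t * v).toNNReal

lemma Lam_eq_rpow_mul_profile (H : ℝ) (f : ℝ≥0 → ℝ) {t : ℝ≥0} (ht : 0 < t) :
    Lam H f t = (t : ℝ) ^ (H - 1 / 2) * profile H f t := by
  have ht' : (0 : ℝ) < t := ht
  have h₁ := integral_homogeneous_mul (e := fun s => f t - f s.toNNReal) ht'
    (dK₁_mul (H := H) ht')
  have h₂ := integral_homogeneous_mul (e := fun s => f s.toNNReal) ht' (dK₂_mul (H := H) ht')
  rw [show H - 3 / 2 + 1 = H - 1 / 2 by ring] at h₁ h₂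
  simp only [Lam, profile, mul_comm (f t - _)]
  rw [h₁, h₂, mul_sub]

section Holder

variable {H b : ℝ} {K γ T : ℝ≥0} {f : ℝ≥0 → ℝ}

lemma abs_sub_le_of_holderOnWith (hf : HolderOnWith K γ f (Set.Iic T)) {s t : ℝ} (hs : 0 ≤ s)
    (hst : s ≤ t) (ht : t ≤ T) :
    |f t.toNNReal - f s.toNNReal| ≤ K * (t - s) ^ (γ : ℝ) := by
  have h := hf.dist_le (x := t.toNNReal) (y := s.toNNReal) (Real.toNNReal_le_iff_le_coe.2 ht)
    (Real.toNNReal_le_iff_le_coe.2 (hst.trans ht))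
  rwa [Real.dist_eq, NNReal.dist_eq, Real.coe_toNNReal _ hs, Real.coe_toNNReal _ (hs.trans hst),
    abs_of_nonneg (sub_nonneg.2 hst)] at h

lemma abs_le_of_holderOnWith (hf : HolderOnWith K γ f (Set.Iic T)) (hf0 : f 0 = 0) {s : ℝ}
    (hs : 0 ≤ s) (hsT : s ≤ T) : |f s.toNNReal| ≤ K * s ^ (γ : ℝ) := by
  simpa [hf0] using abs_sub_le_of_holderOnWith hf le_rfl hs hsT

lemma abs_sub_comp_mul_le (hf : HolderOnWith K γ f (Set.Iic T)) {t : ℝ≥0} (ht : t ≤ T) :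
    ∀ v ∈ Set.Ioo (0 : ℝ) 1,
      |f t - f (t * v).toNNReal| ≤ K * (t : ℝ) ^ (γ : ℝ) * (1 - v) ^ (γ : ℝ) := by
  intro v hv
  have h := abs_sub_le_of_holderOnWith hf (s := t * v) (t := t) (mul_nonneg t.coe_nonneg hv.1.le)
    (mul_le_of_le_one_right t.coe_nonneg hv.2.le) ht
  rwa [Real.toNNReal_coe, show (t : ℝ) - t * v = t * (1 - v) by ring,
    Real.mul_rpow t.coe_nonneg (sub_nonneg.2 hv.2.le), ← mul_assoc] at h

lemma abs_comp_mul_le (hf : HolderOnWith K γ f (Set.Iic T)) (hf0 : f 0 = 0) {t : ℝ≥0}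
    (ht : t ≤ T) :
    ∀ v ∈ Set.Ioo (0 : ℝ) 1, |f (t * v).toNNReal| ≤ K * (t : ℝ) ^ (γ : ℝ) * v ^ (γ : ℝ) := by
  intro v hv
  have h := abs_le_of_holderOnWith hf hf0 (mul_nonneg t.coe_nonneg hv.1.le)
    ((mul_le_of_le_one_right t.coe_nonneg hv.2.le).trans (NNReal.coe_le_coe.2 ht))
  rwa [Real.mul_rpow t.coe_nonneg hv.1.le, ← mul_assoc] at h

lemma abs_comp_mul_sub_comp_mul_le (hf : HolderOnWith K γ f (Set.Iic T)) {r t : ℝ≥0}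
    (hrt : r ≤ t) (ht : t ≤ T) :
    ∀ v ∈ Set.Ioo (0 : ℝ) 1, |f (t * v).toNNReal - f (r * v).toNNReal| ≤
      K * ((t : ℝ) - r) ^ (γ : ℝ) * v ^ (γ : ℝ) := by
  intro v hv
  have hrt' : (r : ℝ) ≤ t := hrt
  have h := abs_sub_le_of_holderOnWith hf (mul_nonneg r.coe_nonneg hv.1.le)
    (mul_le_mul_of_nonneg_right hrt' hv.1.le)
    ((mul_le_of_le_one_right t.coe_nonneg hv.2.le).trans (NNReal.coe_le_coe.2 ht))
  rwa [← sub_mul, Real.mul_rpow (sub_nonneg.2 hrt') hv.1.le, ← mul_assoc] at h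

-- Pairing the four values by time or by path gives `2K (t - r)^γ` and `2K (t (1 - v))^γ`.
lemma abs_second_difference_le (hf : HolderOnWith K γ f (Set.Iic T)) (hb : 0 ≤ b) (hbγ : b < γ)
    {r t : ℝ≥0} (hrt : r ≤ t) (ht : t ≤ T) :
    ∀ v ∈ Set.Ioo (0 : ℝ) 1, |(f t - f (t * v).toNNReal) - (f r - f (r * v).toNNReal)| ≤
      2 * K * ((t : ℝ) - r) ^ (γ - b) * (t : ℝ) ^ b * (1 - v) ^ b := by
  intro v hv
  have hγ : (0 : ℝ) < γ := hb.trans_lt hbγ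
  have hv1 : 0 ≤ 1 - v := sub_nonneg.2 hv.2.le
  have hd : (0 : ℝ) ≤ t - r := sub_nonneg.2 hrt
  have htime : |(f t - f (t * v).toNNReal) - (f r - f (r * v).toNNReal)| ≤
      2 * K * ((t : ℝ) - r) ^ (γ : ℝ) := by
    have hend := abs_sub_le_of_holderOnWith hf r.coe_nonneg (NNReal.coe_le_coe.2 hrt)
      (NNReal.coe_le_coe.2 ht)
    rw [Real.toNNReal_coe, Real.toNNReal_coe] at hend
    have hmid := (abs_comp_mul_sub_comp_mul_le hf hrt ht v hv).trans
      (mul_le_of_le_one_right (by positivity) (Real.rpow_le_one hv.1.le hv.2.le hγ.le))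
    rw [sub_sub_sub_comm]
    exact (abs_sub _ _).trans (by linarith)
  have hpath : |(f t - f (t * v).toNNReal) - (f r - f (r * v).toNNReal)| ≤
      2 * K * (t * (1 - v)) ^ (γ : ℝ) := by
    have hr : K * (r : ℝ) ^ (γ : ℝ) * (1 - v) ^ (γ : ℝ) ≤
        K * (t : ℝ) ^ (γ : ℝ) * (1 - v) ^ (γ : ℝ) := by gcongr
    rw [Real.mul_rpow t.coe_nonneg hv1]
    refine (abs_sub _ _).trans ?_
    linarith [abs_sub_comp_mul_le hf ht v hv, abs_sub_comp_mul_le hf (hrt.trans ht) v hv]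
  have h := le_mul_rpow_mul_rpow (abs_nonneg _) (by positivity) hd (by positivity) hb hbγ.le hγ
    htime hpath
  rwa [Real.mul_rpow t.coe_nonneg hv1, ← mul_assoc] at h

lemma intervalIntegrable_dK₁_mul_sub_comp_mul (hf : HolderOnWith K γ f (Set.Iic T))
    (hm : Measurable f) (hH : H < 1 / 2) (hγ : 1 / 2 - H < γ) {t : ℝ≥0} (ht : t ≤ T) :
    IntervalIntegrable (fun v => dK₁ H 1 v * (f t - f (t * v).toNNReal)) volume 0 1 :=
  intervalIntegrable_mul_of_abs_le (measurable_dK₁ H 1) (by fun_prop)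
    (intervalIntegrable_dK₁_mul hH hγ) (abs_sub_comp_mul_le hf ht)

lemma intervalIntegrable_dK₂_mul_comp_mul (hf : HolderOnWith K γ f (Set.Iic T))
    (hm : Measurable f) (hf0 : f 0 = 0) (hH0 : 0 < H) (hH : H < 1 / 2) (hγ : 1 / 2 - H < γ)
    {t : ℝ≥0} (ht : t ≤ T) :
    IntervalIntegrable (fun v => dK₂ H 1 v * f (t * v).toNNReal) volume 0 1 :=
  intervalIntegrable_mul_of_abs_le (measurable_dK₂ H 1) (by fun_prop)
    (intervalIntegrable_dK₂_mul hH0 hH hγ) (abs_comp_mul_le hf hf0 ht)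

lemma abs_profile_le (hf : HolderOnWith K γ f (Set.Iic T)) (hf0 : f 0 = 0) (hH0 : 0 < H)
    (hH : H < 1 / 2) (hγ : 1 / 2 - H < γ) {t : ℝ≥0} (ht : t ≤ T) :
    |profile H f t| ≤ K * (t : ℝ) ^ (γ : ℝ) * (mass₁ H γ + mass₂ H γ) := by
  rw [mul_add]
  exact (abs_sub _ _).trans (add_le_add
    (abs_integral_mul_le (intervalIntegrable_dK₁_mul hH hγ) (abs_sub_comp_mul_le hf ht)
      (by positivity))
    (abs_integral_mul_le (intervalIntegrable_dK₂_mul hH0 hH hγ) (abs_comp_mul_le hf hf0 ht)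
      (by positivity)))

lemma abs_profile_sub_le (hf : HolderOnWith K γ f (Set.Iic T)) (hm : Measurable f)
    (hf0 : f 0 = 0) (hH0 : 0 < H) (hH : H < 1 / 2) (hb : 1 / 2 - H < b) (hbγ : b < γ)
    {r t : ℝ≥0} (hrt : r ≤ t) (ht : t ≤ T) :
    |profile H f t - profile H f r| ≤
      2 * K * ((t : ℝ) - r) ^ (γ - b) * (t : ℝ) ^ b * mass₁ H b +
        K * ((t : ℝ) - r) ^ (γ : ℝ) * mass₂ H γ := by
  have hγ : 1 / 2 - H < γ := hb.trans hbγ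
  have hd : (0 : ℝ) ≤ t - r := sub_nonneg.2 hrt
  have hdiff : profile H f t - profile H f r =
      (∫ v in (0 : ℝ)..1, dK₁ H 1 v * ((f t - f (t * v).toNNReal) - (f r - f (r * v).toNNReal))) -
        ∫ v in (0 : ℝ)..1, dK₂ H 1 v * (f (t * v).toNNReal - f (r * v).toNNReal) := by
    simp only [mul_sub (dK₁ H 1 _) (f t - _), mul_sub (dK₂ H 1 _)]
    rw [intervalIntegral.integral_sub (intervalIntegrable_dK₁_mul_sub_comp_mul hf hm hH hγ ht)
        (intervalIntegrable_dK₁_mul_sub_comp_mul hf hm hH hγ (hrt.trans ht)),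
      intervalIntegral.integral_sub (intervalIntegrable_dK₂_mul_comp_mul hf hm hf0 hH0 hH hγ ht)
        (intervalIntegrable_dK₂_mul_comp_mul hf hm hf0 hH0 hH hγ (hrt.trans ht)),
      profile, profile]
    ring
  rw [hdiff]
  exact (abs_sub _ _).trans (add_le_add
    (abs_integral_mul_le (intervalIntegrable_dK₁_mul hH hb)
      (abs_second_difference_le hf (by linarith) hbγ hrt ht) (by positivity))
    (abs_integral_mul_le (intervalIntegrable_dK₂_mul hH0 hH hγ)
      (abs_comp_mul_sub_comp_mul_le hf hrt ht) (by positivity)))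

lemma rpow_sub_le_rpow_mul {a γ' d : ℝ} (hd : 0 < d) (hdT : d ≤ T) (hab : a ≤ b) :
    d ^ (γ' - a) ≤ (T : ℝ) ^ (b - a) * d ^ (γ' - b) := by
  rw [show γ' - a = (b - a) + (γ' - b) by ring, Real.rpow_add hd]
  have := sub_nonneg.2 hab
  gcongr

lemma abs_rpow_mul_profile_sub_le (hf : HolderOnWith K γ f (Set.Iic T)) (hm : Measurable f)
    (hf0 : f 0 = 0) (hH0 : 0 < H) (hH : H < 1 / 2) (hb : 1 / 2 - H < b) (hbγ : b < γ)
    {r t : ℝ≥0} (hrt : r < t) (ht : t ≤ T) :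
    |(t : ℝ) ^ (H - 1 / 2) * (profile H f t - profile H f r)| ≤
      (T : ℝ) ^ (b - (1 / 2 - H)) * (2 * mass₁ H b + mass₂ H γ) * K *
        ((t : ℝ) - r) ^ (γ - b) := by
  have hd : (0 : ℝ) < t - r := sub_pos.2 hrt
  have ht0 : (0 : ℝ) < t := (zero_le (a := r)).trans_lt hrt
  have hm₁ := mass₁_nonneg H b
  have hm₂ := mass₂_nonneg H γ
  have hbound := mul_le_mul_of_nonneg_left (abs_profile_sub_le hf hm hf0 hH0 hH hb hbγ hrt.le ht)
    (Real.rpow_nonneg ht0.le (H - 1 / 2))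
  have htb : (t : ℝ) ^ (H - 1 / 2) * (t : ℝ) ^ b ≤ (T : ℝ) ^ (b - (1 / 2 - H)) := by
    rw [← Real.rpow_add ht0, show H - 1 / 2 + b = b - (1 / 2 - H) by ring]
    exact Real.rpow_le_rpow ht0.le (NNReal.coe_le_coe.2 ht) (by linarith)
  have hdγ : (t : ℝ) ^ (H - 1 / 2) * ((t : ℝ) - r) ^ (γ : ℝ) ≤
      (T : ℝ) ^ (b - (1 / 2 - H)) * ((t : ℝ) - r) ^ (γ - b) := by
    refine le_trans ?_ (rpow_sub_le_rpow_mul hd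
      ((sub_le_self _ r.coe_nonneg).trans (NNReal.coe_le_coe.2 ht)) hb.le)
    rw [show (γ : ℝ) - (1 / 2 - H) = (H - 1 / 2) + γ by ring, Real.rpow_add hd]
    exact mul_le_mul_of_nonneg_right
      (Real.rpow_le_rpow_of_nonpos hd (sub_le_self _ r.coe_nonneg) (by linarith)) (by positivity)
  have htb' := mul_le_mul_of_nonneg_right htb
    (show 0 ≤ 2 * K * ((t : ℝ) - r) ^ (γ - b) * mass₁ H b by positivity)
  have hdγ' := mul_le_mul_of_nonneg_right hdγ (show 0 ≤ K * mass₂ H γ by positivity)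
  rw [abs_mul, abs_of_nonneg (Real.rpow_nonneg ht0.le _)]
  linarith

lemma abs_rpow_sub_rpow_mul_profile_le (hf : HolderOnWith K γ f (Set.Iic T)) (hf0 : f 0 = 0)
    (hH0 : 0 < H) (hH : H < 1 / 2) (hγ : 1 / 2 - H < γ) (hγ1 : γ ≤ 1) {r t : ℝ≥0} (hr : 0 < r)
    (hrt : r ≤ t) (ht : t ≤ T) :
    |((t : ℝ) ^ (H - 1 / 2) - (r : ℝ) ^ (H - 1 / 2)) * profile H f r| ≤
      K * (mass₁ H γ + mass₂ H γ) * ((t : ℝ) - r) ^ (γ - (1 / 2 - H)) := by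
  have hpow := abs_rpow_neg_sub_rpow_neg_mul_rpow_le (a := 1 / 2 - H) (sub_pos.2 hH)
    (by linarith) hγ (NNReal.coe_le_coe.2 hγ1) (NNReal.coe_pos.2 hr) (NNReal.coe_le_coe.2 hrt)
  rw [neg_sub] at hpow
  have hmass : 0 ≤ mass₁ H γ + mass₂ H γ := add_nonneg (mass₁_nonneg _ _) (mass₂_nonneg _ _)
  rw [abs_mul]
  calc _ ≤ |(t : ℝ) ^ (H - 1 / 2) - (r : ℝ) ^ (H - 1 / 2)| *
        (K * (r : ℝ) ^ (γ : ℝ) * (mass₁ H γ + mass₂ H γ)) := by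
        gcongr; exact abs_profile_le hf hf0 hH0 hH hγ (hrt.trans ht)
    _ = K * (mass₁ H γ + mass₂ H γ) *
        (|(t : ℝ) ^ (H - 1 / 2) - (r : ℝ) ^ (H - 1 / 2)| * (r : ℝ) ^ (γ : ℝ)) := by ring
    _ ≤ _ := by gcongr

lemma abs_Lam_le (hf : HolderOnWith K γ f (Set.Iic T)) (hf0 : f 0 = 0) (hH0 : 0 < H)
    (hH : H < 1 / 2) (hγ : 1 / 2 - H < γ) {t : ℝ≥0} (ht0 : 0 < t) (ht : t ≤ T) :
    |Lam H f t| ≤ K * (mass₁ H γ + mass₂ H γ) * (t : ℝ) ^ (γ - (1 / 2 - H)) := by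
  have ht0' : (0 : ℝ) < t := ht0
  rw [Lam_eq_rpow_mul_profile H f ht0, abs_mul, abs_of_nonneg (by positivity)]
  calc _ ≤ (t : ℝ) ^ (H - 1 / 2) * (K * (t : ℝ) ^ (γ : ℝ) * (mass₁ H γ + mass₂ H γ)) := by
        gcongr; exact abs_profile_le hf hf0 hH0 hH hγ ht
    _ = _ := by
        rw [show (γ : ℝ) - (1 / 2 - H) = (H - 1 / 2) + γ by ring, Real.rpow_add ht0']; ring

lemma Lam_zero (H : ℝ) (f : ℝ≥0 → ℝ) : Lam H f 0 = 0 := by simp [Lam]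

lemma exists_abs_Lam_sub_le (hH0 : 0 < H) (hH : H < 1 / 2) (hb : 1 / 2 - H < b) (hbγ : b < γ)
    (hγ1 : γ ≤ 1) (T : ℝ≥0) :
    ∃ C ≥ (0 : ℝ), ∀ (K : ℝ≥0) (f : ℝ≥0 → ℝ), Measurable f → f 0 = 0 →
      HolderOnWith K γ f (Set.Iic T) → ∀ r t : ℝ≥0, r ≤ t → t ≤ T →
        |Lam H f t - Lam H f r| ≤ C * K * ((t : ℝ) - r) ^ (γ - b) := by
  have hm₁ := mass₁_nonneg H b
  have hm₂ := mass₂_nonneg H γ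
  have hm := add_nonneg (mass₁_nonneg H γ) hm₂
  refine ⟨(T : ℝ) ^ (b - (1 / 2 - H)) *
    ((2 * mass₁ H b + mass₂ H γ) + (mass₁ H γ + mass₂ H γ)), by positivity,
    fun K f hmeas hf0 hf r t hrt ht => ?_⟩
  rcases hrt.eq_or_lt with rfl | hlt
  · simp only [sub_self, abs_zero]
    positivity
  have hd : (0 : ℝ) < t - r := sub_pos.2 hlt
  have hpow : ((t : ℝ) - r) ^ (γ - (1 / 2 - H)) ≤
      (T : ℝ) ^ (b - (1 / 2 - H)) * ((t : ℝ) - r) ^ (γ - b) :=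
    rpow_sub_le_rpow_mul hd ((sub_le_self _ r.coe_nonneg).trans (NNReal.coe_le_coe.2 ht)) hb.le
  have hpow' := mul_le_mul_of_nonneg_left hpow
    (show 0 ≤ K * (mass₁ H γ + mass₂ H γ) by positivity)
  rcases (zero_le (a := r)).eq_or_lt with rfl | hr
  · have hΛ := abs_Lam_le hf hf0 hH0 hH (hb.trans hbγ) hlt ht
    rw [NNReal.coe_zero, sub_zero] at hpow' hd ⊢
    have : 0 ≤ (T : ℝ) ^ (b - (1 / 2 - H)) * (2 * mass₁ H b + mass₂ H γ) * K *
      (t : ℝ) ^ (γ - b) := by positivity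
    rw [Lam_zero, sub_zero]
    linarith
  · have hΦ := abs_rpow_mul_profile_sub_le hf hmeas hf0 hH0 hH hb hbγ hlt ht
    have hpre := abs_rpow_sub_rpow_mul_profile_le hf hf0 hH0 hH (hb.trans hbγ) hγ1 hr hrt ht
    rw [Lam_eq_rpow_mul_profile H f (hr.trans hlt), Lam_eq_rpow_mul_profile H f hr,
      show (t : ℝ) ^ (H - 1 / 2) * profile H f t - (r : ℝ) ^ (H - 1 / 2) * profile H f r =
        (t : ℝ) ^ (H - 1 / 2) * (profile H f t - profile H f r) +
          ((t : ℝ) ^ (H - 1 / 2) - (r : ℝ) ^ (H - 1 / 2)) * profile H f r by ring]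
    refine (abs_add_le _ _).trans ?_
    linarith

end Holder

/-! ### The embedded times of a continuous path -/

section Times

variable {f : ℝ≥0 → ℝ} {ε : ℝ}

lemma knightTime_succ (f : ℝ≥0 → ℝ) (ε : ℝ) (n : ℕ) :
    knightTime f ε (n + 1) = ⨅ (t : ℝ≥0) (_ : knightTime f ε n < t ∧
      |f t - f (knightTime f ε n).toNNReal| = ε), (t : ℝ≥0∞) := rfl

lemma knightTime_mono (f : ℝ≥0 → ℝ) (ε : ℝ) : Monotone (knightTime f ε) :=
  monotone_nat_of_le_succ fun n => by
    rw [knightTime_succ]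
    exact le_iInf₂ fun t ht => ht.1.le

lemma knightTime_succ_spec (hf : Continuous f) (hε : 0 < ε) {n : ℕ} {a r : ℝ≥0}
    (ha : knightTime f ε n = a) (hr : knightTime f ε (n + 1) = r) :
    a < r ∧ |f r - f a| = ε := by
  set S : Set ℝ≥0 := {t | a < t ∧ |f t - f a| = ε} with hS
  have hinf : knightTime f ε (n + 1) = ⨅ t ∈ S, (t : ℝ≥0∞) := by
    rw [knightTime_succ, ha]
    simp [hS]
  have hne : S.Nonempty := by
    by_contra h
    rw [Set.not_nonempty_iff_eq_empty] at h
    rw [hinf, h] at hr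
    simp at hr
  rw [← ENNReal.coe_sInf hne, hr, ENNReal.coe_inj] at hinf
  have hclosed : IsClosed {t : ℝ≥0 | a ≤ t ∧ |f t - f a| = ε} :=
    (isClosed_le continuous_const continuous_id).inter
      (isClosed_eq (by fun_prop) continuous_const)
  have hmem : r ∈ {t : ℝ≥0 | a ≤ t ∧ |f t - f a| = ε} := by
    rw [hinf]
    exact hclosed.closure_subset_iff.2 (fun t ht => ⟨ht.1.le, ht.2⟩)
      (csInf_mem_closure hne (OrderBot.bddBelow S))
  refine ⟨lt_of_le_of_ne hmem.1 ?_, hmem.2⟩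
  rintro rfl
  exact hε.ne (by simpa using hmem.2)

lemma knightTime_lt_succ (hf : Continuous f) (hε : 0 < ε) {n : ℕ}
    (h : knightTime f ε n ≠ ∞) : knightTime f ε n < knightTime f ε (n + 1) := by
  rcases eq_or_ne (knightTime f ε (n + 1)) ∞ with h' | h'
  · rw [h']; exact h.lt_top
  · lift knightTime f ε n to ℝ≥0 using h with a ha
    lift knightTime f ε (n + 1) to ℝ≥0 using h' with r hr
    exact ENNReal.coe_lt_coe.2 (knightTime_succ_spec hf hε ha.symm hr.symm).1

lemma abs_sub_lt_of_lt_knightTime (hf : Continuous f) (hε : 0 < ε) {n : ℕ} {a t : ℝ≥0}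
    (ha : knightTime f ε n = a) (hat : a ≤ t) (ht : t < knightTime f ε (n + 1)) :
    |f t - f a| < ε := by
  by_contra! h
  have hc : ContinuousOn (fun u => |f u - f a|) (Set.Icc a t) := by fun_prop
  obtain ⟨u, hu, hu'⟩ := intermediate_value_Icc hat hc (show ε ∈ Set.Icc _ _ by
    simpa using ⟨hε.le, h⟩)
  have hau : a < u := by
    refine lt_of_le_of_ne hu.1 ?_
    rintro rfl
    exact hε.ne (by simpa using hu')
  have hle : knightTime f ε (n + 1) ≤ u := by
    rw [knightTime_succ, ha]
    exact iInf₂_le u ⟨ENNReal.coe_lt_coe.2 hau, by simpa using hu'⟩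
  exact (ht.trans_le hle).not_ge (ENNReal.coe_le_coe.2 hu.2)

lemma exists_knightTime_gt (hf : Continuous f) (hε : 0 < ε) (s : ℝ≥0) :
    ∃ n, s < knightTime f ε n := by
  by_contra! hle
  have hfin : ∀ n, knightTime f ε n ≠ ∞ := fun n => ne_top_of_le_ne_top ENNReal.coe_ne_top (hle n)
  set u : ℕ → ℝ≥0 := fun n => (knightTime f ε n).toNNReal
  have hmono : Monotone u := fun m n h => ENNReal.toNNReal_mono (hfin n) (knightTime_mono f ε h)
  have hbdd : BddAbove (Set.range u) := ⟨s, by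
    rintro _ ⟨n, rfl⟩
    exact ENNReal.toNNReal_mono ENNReal.coe_ne_top (hle n)⟩
  have hlim := (hf.tendsto _).comp (tendsto_atTop_ciSup hmono hbdd)
  have hgap := ((hlim.comp (tendsto_add_atTop_nat 1)).sub hlim).abs
  rw [sub_self, abs_zero] at hgap
  have hconst : ∀ n, |f (u (n + 1)) - f (u n)| = ε := fun n =>
    (knightTime_succ_spec hf hε (ENNReal.coe_toNNReal (hfin n)).symm
      (ENNReal.coe_toNNReal (hfin (n + 1))).symm).2
  exact hε.ne' (tendsto_nhds_unique tendsto_const_nhds (hgap.congr hconst))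

lemma exists_knightTime_le_lt (hf : Continuous f) (hε : 0 < ε) (s : ℝ≥0) :
    ∃ n, ∃ a : ℝ≥0, knightTime f ε n = a ∧ a ≤ s ∧ s < knightTime f ε (n + 1) := by
  classical
  have hex := exists_knightTime_gt hf hε s
  obtain ⟨n, hn⟩ : ∃ n, Nat.find hex = n + 1 := Nat.exists_eq_succ_of_ne_zero fun h0 => by
    simpa [h0, knightTime] using Nat.find_spec hex
  have hle : knightTime f ε n ≤ s := not_lt.1 (Nat.find_min hex (hn ▸ n.lt_succ_self))
  lift knightTime f ε n to ℝ≥0 using ne_top_of_le_ne_top ENNReal.coe_ne_top hle with a ha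
  exact ⟨n, a, ha.symm, ENNReal.coe_le_coe.1 hle, hn ▸ Nat.find_spec hex⟩

variable {n : ℕ} {a s : ℝ≥0}

lemma knightTime_le_iff (ha : knightTime f ε n = a) (has : a ≤ s)
    (hs : s < knightTime f ε (n + 1)) (m : ℕ) : knightTime f ε m ≤ s ↔ m ≤ n := by
  refine ⟨fun h => ?_, fun h => (knightTime_mono f ε h).trans (ha ▸ ENNReal.coe_le_coe.2 has)⟩
  by_contra! hlt
  exact (hs.trans_le (knightTime_mono f ε hlt)).not_ge h

lemma lastTime_eq (ha : knightTime f ε n = a) (has : a ≤ s)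
    (hs : s < knightTime f ε (n + 1)) : lastTime f ε s = a := by
  refine IsGreatest.csSup_eq ⟨⟨has, n, ha⟩, ?_⟩
  rintro r ⟨hr, m, hm⟩
  have hmn : m ≤ n := (knightTime_le_iff ha has hs m).1 (hm ▸ ENNReal.coe_le_coe.2 hr)
  have hle := knightTime_mono f ε hmn
  rwa [hm, ha, ENNReal.coe_le_coe] at hle

lemma knightWalk_eq (ha : knightTime f ε n = a) (has : a ≤ s)
    (hs : s < knightTime f ε (n + 1)) : knightWalk f ε s = f a - f 0 := by
  rw [knightWalk, tsum_eq_sum (s := Finset.range n)]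
  · rw [Finset.sum_congr rfl fun m hm =>
        if_pos ((knightTime_le_iff ha has hs (m + 1)).2 (Finset.mem_range.1 hm)),
      Finset.sum_range_sub (fun m => f (knightTime f ε m).toNNReal), ha]
    simp [knightTime]
  · intro m hm
    exact if_neg fun h => hm (Finset.mem_range.2 ((knightTime_le_iff ha has hs _).1 h))

lemma nextTime_eq (T : ℝ≥0) (hf : Continuous f) (hε : 0 < ε) (ha : knightTime f ε n = a)
    (has : a ≤ s) (hs : s < knightTime f ε (n + 1)) :
    nextTime f ε T s = (knightTime f ε (n + 1) ⊓ T).toNNReal := by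
  have hfin : knightTime f ε n ≠ ∞ := ha ▸ ENNReal.coe_ne_top
  rw [nextTime, lastTime_eq ha has hs, ← ha]
  congr 2
  refine le_antisymm (iInf₂_le (n + 1) (knightTime_lt_succ hf hε hfin)) (le_iInf₂ fun m hm => ?_)
  refine knightTime_mono f ε ?_
  by_contra! h
  exact hm.not_ge (knightTime_mono f ε (Nat.lt_succ_iff.1 h))

lemma lastTime_le (f : ℝ≥0 → ℝ) (ε : ℝ) (t : ℝ≥0) : lastTime f ε t ≤ t :=
  csSup_le ⟨0, zero_le, 0, by simp [knightTime]⟩ fun _ hr => hr.1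

lemma lastTime_mono (f : ℝ≥0 → ℝ) (ε : ℝ) : Monotone (lastTime f ε) := fun _ t hst =>
  csSup_le_csSup ⟨t, fun _ hr => hr.1⟩ ⟨0, zero_le, 0, by simp [knightTime]⟩
    fun _ hr => ⟨hr.1.trans hst, hr.2⟩

lemma nextTime_mono (f : ℝ≥0 → ℝ) (ε : ℝ) (T : ℝ≥0) : Monotone (nextTime f ε T) := by
  intro s t hst
  refine ENNReal.toNNReal_mono (ne_top_of_le_ne_top ENNReal.coe_ne_top inf_le_right)
    (inf_le_inf_right _ (le_iInf₂ fun n hn => ?_))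
  exact iInf₂_le n ((ENNReal.coe_le_coe.2 (lastTime_mono f ε hst)).trans_lt hn)

lemma knightWalk_eq_lastTime (hf : Continuous f) (hf0 : f 0 = 0) (hε : 0 < ε) (s : ℝ≥0) :
    knightWalk f ε s = f (lastTime f ε s) := by
  obtain ⟨n, a, ha, has, hs⟩ := exists_knightTime_le_lt hf hε s
  rw [knightWalk_eq ha has hs, lastTime_eq ha has hs, hf0, sub_zero]

lemma lastTime_lastTime (hf : Continuous f) (hε : 0 < ε) (s : ℝ≥0) :
    lastTime f ε (lastTime f ε s) = lastTime f ε s := by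
  obtain ⟨n, a, ha, has, hs⟩ := exists_knightTime_le_lt hf hε s
  rw [lastTime_eq ha has hs,
    lastTime_eq ha le_rfl (lt_of_le_of_lt (ENNReal.coe_le_coe.2 has) hs)]

lemma measurable_knightWalk (hf : Continuous f) (hf0 : f 0 = 0) (hε : 0 < ε) :
    Measurable (knightWalk f ε) := by
  rw [funext (knightWalk_eq_lastTime hf hf0 hε)]
  exact hf.measurable.comp (lastTime_mono f ε).measurable

lemma abs_sub_lastTime_le (hf : Continuous f) (hε : 0 < ε) {u : ℝ≥0}
    (hu : lastTime f ε s ≤ u) (hus : u ≤ s) : |f u - f (lastTime f ε s)| ≤ ε := by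
  obtain ⟨n, a, ha, has, hs⟩ := exists_knightTime_le_lt hf hε s
  rw [lastTime_eq ha has hs] at hu ⊢
  exact (abs_sub_lt_of_lt_knightTime hf hε ha hu
    (lt_of_le_of_lt (ENNReal.coe_le_coe.2 hus) hs)).le

lemma nextTime_spec {T t : ℝ≥0} (hf : Continuous f) (hε : 0 < ε) (htT : t ≤ T)
    (hst : s < lastTime f ε t) :
    s ≤ nextTime f ε T s ∧ nextTime f ε T s ≤ lastTime f ε t ∧
      lastTime f ε (nextTime f ε T s) = nextTime f ε T s ∧
      |f (nextTime f ε T s) - f s| ≤ 2 * ε := by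
  obtain ⟨n, a, ha, has, hs⟩ := exists_knightTime_le_lt hf hε s
  obtain ⟨N, c, hc, hct, ht⟩ := exists_knightTime_le_lt hf hε t
  rw [lastTime_eq hc hct ht] at hst ⊢
  have hle : knightTime f ε (n + 1) ≤ c := by
    rw [← hc]
    refine knightTime_mono f ε (Nat.succ_le_of_lt (lt_of_not_ge fun h => ?_))
    have hca := knightTime_mono f ε h
    rw [hc, ha, ENNReal.coe_le_coe] at hca
    exact (hst.trans_le hca).not_ge has
  have hfin : knightTime f ε (n + 1) ≠ ∞ := ne_top_of_le_ne_top ENNReal.coe_ne_top hle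
  obtain ⟨r, hr⟩ : ∃ r : ℝ≥0, knightTime f ε (n + 1) = r :=
    ⟨_, (ENNReal.coe_toNNReal hfin).symm⟩
  have hrc : r ≤ c := ENNReal.coe_le_coe.1 (hr ▸ hle)
  have hsr : s < r := ENNReal.coe_lt_coe.1 (hr ▸ hs)
  have hnext : nextTime f ε T s = r := by
    rw [nextTime_eq T hf hε ha has hs, hr,
      inf_of_le_left (ENNReal.coe_le_coe.2 (hrc.trans (hct.trans htT))), ENNReal.toNNReal_coe]
  rw [hnext]
  refine ⟨hsr.le, hrc, lastTime_eq hr le_rfl (hr ▸ knightTime_lt_succ hf hε hfin), ?_⟩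
  have hjump := (knightTime_succ_spec hf hε ha hr).2
  have hstay := abs_sub_lt_of_lt_knightTime hf hε ha has hs
  rw [abs_sub_comm] at hstay
  linarith [abs_sub_le (f r) (f a) (f s)]

end Times

/-! ### Distance between the approximation and `Λ_H` -/

section Approx

variable {f : ℝ≥0 → ℝ} {H η ε : ℝ} {K γ T t : ℝ≥0}

lemma le_two_mul_rpow_mul_rpow {x d M g : ℝ} (hM : 1 ≤ M) (hη0 : 0 ≤ η) (hη1 : η ≤ 1)
    (hε : 0 ≤ ε) (hd : 0 ≤ d) (hx : 0 ≤ x) (hxε : x ≤ 2 * ε) (hxd : x ≤ M * d ^ g) :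
    x ≤ 2 * M * ε ^ η * d ^ (g * (1 - η)) := by
  have hM0 : 0 ≤ M := zero_le_one.trans hM
  have h := le_rpow_mul_rpow hx hxε hxd (θ := 1 - η) (by linarith) (by linarith)
  rw [sub_sub_cancel, Real.mul_rpow two_pos.le hε, Real.mul_rpow hM0
    (Real.rpow_nonneg hd _), ← Real.rpow_mul hd] at h
  have h2 : (2 : ℝ) ^ η ≤ 2 := by
    simpa using Real.rpow_le_rpow_of_exponent_le one_le_two hη1
  have hM' : M ^ (1 - η) ≤ M := by
    simpa using Real.rpow_le_rpow_of_exponent_le hM (show 1 - η ≤ 1 by linarith)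
  calc x ≤ 2 ^ η * ε ^ η * (M ^ (1 - η) * d ^ (g * (1 - η))) := h
    _ ≤ 2 * ε ^ η * (M * d ^ (g * (1 - η))) := by gcongr
    _ = 2 * M * ε ^ η * d ^ (g * (1 - η)) := by ring

lemma abs_knightWalk_nextTime_error_le (hf : HolderOnWith K γ f (Set.Iic T))
    (hc : Continuous f) (hf0 : f 0 = 0) (hK : 1 ≤ K) (hη0 : 0 ≤ η) (hη1 : η ≤ 1) (hε : 0 < ε)
    (ht : t ≤ T) :
    ∀ s ∈ Set.Ioo 0 (lastTime f ε t : ℝ),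
      |(knightWalk f ε (lastTime f ε t) - knightWalk f ε (nextTime f ε T s.toNNReal)) -
          (f (lastTime f ε t) - f s.toNNReal)| ≤
        2 * K * ε ^ η * (lastTime f ε t - s) ^ (γ * (1 - η)) := by
  intro s hs
  have hsτ : s.toNNReal < lastTime f ε t := (Real.toNNReal_lt_iff_lt_coe hs.1.le).2 hs.2
  obtain ⟨hs_next, hnext_τ, hlast, hfar⟩ := nextTime_spec hc hε ht hsτ
  set u := nextTime f ε T s.toNNReal
  have herr : (knightWalk f ε (lastTime f ε t) - knightWalk f ε u) -
      (f (lastTime f ε t) - f s.toNNReal) = -(f u - f s.toNNReal) := by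
    rw [knightWalk_eq_lastTime hc hf0 hε, knightWalk_eq_lastTime hc hf0 hε,
      lastTime_lastTime hc hε, hlast]
    ring
  have hsu : s ≤ u := Real.toNNReal_le_iff_le_coe.1 hs_next
  have huτ : (u : ℝ) ≤ lastTime f ε t := hnext_τ
  have hτT : (lastTime f ε t : ℝ) ≤ T := (lastTime_le f ε t).trans ht
  have hholder := abs_sub_le_of_holderOnWith hf hs.1.le hsu (huτ.trans hτT)
  rw [Real.toNNReal_coe] at hholder
  rw [herr, abs_neg]
  refine le_two_mul_rpow_mul_rpow (NNReal.coe_le_coe.2 hK) hη0 hη1 hε.le (sub_nonneg.2 hs.2.le)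
    (abs_nonneg _) hfar (hholder.trans ?_)
  have : 0 ≤ (u : ℝ) - s := sub_nonneg.2 hsu
  gcongr

lemma abs_knightWalk_sub_le (hf : HolderOnWith K γ f (Set.Iic T)) (hc : Continuous f)
    (hf0 : f 0 = 0) (hK : 1 ≤ K) (hη0 : 0 ≤ η) (hη1 : η ≤ 1) (hε : 0 < ε) {s : ℝ} (hs : 0 ≤ s)
    (hsT : s ≤ T) :
    |knightWalk f ε s.toNNReal - f s.toNNReal| ≤ 2 * K * ε ^ η * s ^ (γ * (1 - η)) := by
  have hle := lastTime_le f ε s.toNNReal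
  have hle' : (lastTime f ε s.toNNReal : ℝ) ≤ s :=
    (NNReal.coe_le_coe.2 hle).trans_eq (Real.coe_toNNReal s hs)
  have hholder := abs_sub_le_of_holderOnWith hf (lastTime f ε s.toNNReal).coe_nonneg hle' hsT
  rw [Real.toNNReal_coe] at hholder
  rw [knightWalk_eq_lastTime hc hf0 hε, abs_sub_comm]
  refine le_two_mul_rpow_mul_rpow (NNReal.coe_le_coe.2 hK) hη0 hη1 hε.le hs (abs_nonneg _)
    ((abs_sub_lastTime_le hc hε hle le_rfl).trans (by linarith)) (hholder.trans ?_)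
  have : 0 ≤ s - lastTime f ε s.toNNReal := sub_nonneg.2 hle'
  gcongr
  exact sub_le_self _ (NNReal.coe_nonneg _)

lemma approx_sub_Lam_lastTime (hf : HolderOnWith K γ f (Set.Iic T)) (hc : Continuous f)
    (hf0 : f 0 = 0) (hK : 1 ≤ K) (hH0 : 0 < H) (hH : H < 1 / 2) (hγ : 1 / 2 - H < γ)
    (hε : 0 < ε) (ht : t ≤ T) (hτ : 0 < (lastTime f ε t : ℝ)) :
    approx H T f ε t - Lam H f (lastTime f ε t) =
      (∫ s in (0 : ℝ)..lastTime f ε t, dK₁ H (lastTime f ε t) s *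
        ((knightWalk f ε (lastTime f ε t) - knightWalk f ε (nextTime f ε T s.toNNReal)) -
          (f (lastTime f ε t) - f s.toNNReal))) -
      ∫ s in (0 : ℝ)..lastTime f ε t, dK₂ H (lastTime f ε t) s *
        (knightWalk f ε s.toNNReal - f s.toNNReal) := by
  have hw := measurable_knightWalk hc hf0 hε
  have hnext := (nextTime_mono f ε T).measurable
  have hτT : (lastTime f ε t : ℝ) ≤ T := (lastTime_le f ε t).trans ht
  have hγ0 : 1 / 2 - H < γ * (1 - 0) := by simpa using hγ
  have hpath₁ : IntervalIntegrable
      (fun s => dK₁ H (lastTime f ε t) s * (f (lastTime f ε t) - f s.toNNReal)) volume 0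
      (lastTime f ε t) :=
    intervalIntegrable_dK₁_mul_of_abs_le hH hγ hτ (by fun_prop) fun s hs => by
      simpa using abs_sub_le_of_holderOnWith hf hs.1.le hs.2.le hτT
  have hpath₂ : IntervalIntegrable (fun s => dK₂ H (lastTime f ε t) s * f s.toNNReal) volume 0
      (lastTime f ε t) :=
    intervalIntegrable_dK₂_mul_of_abs_le hH0 hH hγ hτ (by fun_prop) fun s hs =>
      abs_le_of_holderOnWith hf hf0 hs.1.le (hs.2.le.trans hτT)
  have herr₁ := intervalIntegrable_dK₁_mul_of_abs_le hH hγ0 hτ (by fun_prop)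
    (abs_knightWalk_nextTime_error_le hf hc hf0 hK le_rfl zero_le_one hε ht)
  have herr₂ := intervalIntegrable_dK₂_mul_of_abs_le hH0 hH hγ0 hτ
    (e := fun s => knightWalk f ε s.toNNReal - f s.toNNReal) (by fun_prop) fun s hs =>
      abs_knightWalk_sub_le hf hc hf0 hK le_rfl zero_le_one hε hs.1.le (hs.2.le.trans hτT)
  have hsum₁ := intervalIntegral.integral_add herr₁ hpath₁
  have hsum₂ := intervalIntegral.integral_add herr₂ hpath₂
  simp only [← mul_add, sub_add_cancel] at hsum₁ hsum₂
  simp only [approx, Lam, hsum₁, hsum₂, mul_comm (f _ - _) (dK₁ _ _ _)]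
  ring

lemma exists_abs_approx_sub_Lam_lastTime_le (hH0 : 0 < H) (hH : H < 1 / 2) (hη0 : 0 ≤ η)
    (hη1 : η ≤ 1) (hγη : 1 / 2 - H < γ * (1 - η)) (T : ℝ≥0) :
    ∃ C ≥ (0 : ℝ), ∀ (K : ℝ≥0) (f : ℝ≥0 → ℝ), 1 ≤ K → Continuous f → f 0 = 0 →
      HolderOnWith K γ f (Set.Iic T) → ∀ ε > 0, ∀ t ≤ T,
        |approx H T f ε t - Lam H f (lastTime f ε t)| ≤ C * K * ε ^ η := by
  set b := γ * (1 - η)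
  have hγ : 1 / 2 - H < γ := hγη.trans_le (mul_le_of_le_one_right γ.coe_nonneg (by linarith))
  have hm₁ := mass₁_nonneg H b
  have hm₂ := mass₂_nonneg H b
  refine ⟨2 * (T : ℝ) ^ (b - (1 / 2 - H)) * (mass₁ H b + mass₂ H b), by positivity,
    fun K f hK hc hf0 hf ε hε t ht => ?_⟩
  set τ := lastTime f ε t with hτ_def
  have hτT : (τ : ℝ) ≤ T := (lastTime_le f ε t).trans ht
  rcases τ.coe_nonneg.eq_or_lt with h0 | hτ
  · rw [approx, Lam, ← hτ_def, ← h0]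
    simp only [intervalIntegral.integral_same, sub_self, abs_zero]
    positivity
  have herr₁ := abs_integral_dK₁_mul_le hH hγη hτ (by positivity)
    (abs_knightWalk_nextTime_error_le hf hc hf0 hK hη0 hη1 hε ht)
  have herr₂ := abs_integral_dK₂_mul_le hH0 hH hγη hτ (c := 2 * K * ε ^ η)
    (e := fun s => knightWalk f ε s.toNNReal - f s.toNNReal) (by positivity) fun s hs =>
      abs_knightWalk_sub_le hf hc hf0 hK hη0 hη1 hε hs.1.le (hs.2.le.trans hτT)
  rw [approx_sub_Lam_lastTime hf hc hf0 hK hH0 hH hγ hε ht hτ]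
  calc _ ≤ 2 * K * ε ^ η * (τ : ℝ) ^ (b - (1 / 2 - H)) * mass₁ H b +
        2 * K * ε ^ η * (τ : ℝ) ^ (b - (1 / 2 - H)) * mass₂ H b :=
        (abs_sub _ _).trans (add_le_add herr₁ herr₂)
    _ = 2 * (τ : ℝ) ^ (b - (1 / 2 - H)) * (mass₁ H b + mass₂ H b) * K * ε ^ η := by ring
    _ ≤ 2 * (T : ℝ) ^ (b - (1 / 2 - H)) * (mass₁ H b + mass₂ H b) * K * ε ^ η := by
        have := sub_nonneg.2 hγη.le
        gcongr

lemma exists_abs_approx_sub_Lam_le (hH0 : 0 < H) (hH : H < 1 / 2) (hη0 : 0 ≤ η) (hη1 : η ≤ 1)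
    (hγη : 1 / 2 - H < γ * (1 - η)) (hγH : 1 / 2 - H < γ * (1 - H)) (hγ1 : γ ≤ 1) (T : ℝ≥0) :
    ∃ C ≥ (0 : ℝ), ∀ (K : ℝ≥0) (f : ℝ≥0 → ℝ), 1 ≤ K → Continuous f → f 0 = 0 →
      HolderOnWith K γ f (Set.Iic T) → ∀ ε > 0, ∀ t ≤ T,
        |approx H T f ε t - Lam H f t| ≤
          C * K * (ε ^ η + ((t : ℝ) - lastTime f ε t) ^ (γ * H)) := by
  have hγ0 : (0 : ℝ) < γ := pos_of_mul_pos_left (b := 1 - H) (by linarith) (by linarith)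
  obtain ⟨C₁, hC₁, happrox⟩ := exists_abs_approx_sub_Lam_lastTime_le hH0 hH hη0 hη1 hγη T
  obtain ⟨C₂, hC₂, hLam⟩ := exists_abs_Lam_sub_le hH0 hH hγH
    (mul_lt_of_lt_one_right hγ0 (by linarith)) hγ1 T
  refine ⟨C₁ + C₂, by positivity, fun K f hK hc hf0 hf ε hε t ht => ?_⟩
  have hτt := lastTime_le f ε t
  have h₁ := happrox K f hK hc hf0 hf ε hε t ht
  have h₂ := hLam K f hc.measurable hf0 hf _ t hτt ht
  rw [show (γ : ℝ) - γ * (1 - H) = γ * H by ring, abs_sub_comm] at h₂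
  have hgap : 0 ≤ ((t : ℝ) - lastTime f ε t) ^ (γ * H) :=
    Real.rpow_nonneg (sub_nonneg.2 hτt) _
  calc |approx H T f ε t - Lam H f t| ≤
        |approx H T f ε t - Lam H f (lastTime f ε t)| +
          |Lam H f (lastTime f ε t) - Lam H f t| := abs_sub_le _ _ _
    _ ≤ C₁ * K * ε ^ η + C₂ * K * ((t : ℝ) - lastTime f ε t) ^ (γ * H) := add_le_add h₁ h₂
    _ ≤ (C₁ + C₂) * K * ε ^ η + (C₁ + C₂) * K * ((t : ℝ) - lastTime f ε t) ^ (γ * H) := by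
        gcongr <;> linarith
    _ = _ := by ring

end Approx

/-! ### Dyadic chaining -/

section Chaining

/-- The dyadic point `k T / 2 ^ n` of `[0, T]`. -/
noncomputable def dyad (T : ℝ≥0) (n k : ℕ) : ℝ≥0 := k * T / 2 ^ n

lemma dyad_two_mul (T : ℝ≥0) (n k : ℕ) : dyad T (n + 1) (2 * k) = dyad T n k := by
  rw [dyad, dyad, pow_succ]
  push_cast
  rw [mul_assoc, mul_comm (2 ^ n : ℝ≥0) 2, mul_div_mul_left _ _ two_ne_zero]

/-- The index of the last dyadic point of level `n` before `t`. -/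
noncomputable def dyadIndex (T t : ℝ≥0) (n : ℕ) : ℕ := ⌊(t / T : ℝ) * 2 ^ n⌋₊

lemma tendsto_dyad_dyadIndex {T : ℝ≥0} (hT : 0 < T) (t : ℝ≥0) :
    Tendsto (fun n => dyad T n (dyadIndex T t n)) atTop (𝓝 t) := by
  have hT' : (T : ℝ) ≠ 0 := (NNReal.coe_pos.2 hT).ne'
  have hpow : Tendsto (fun n : ℕ => (2 : ℝ) ^ n) atTop atTop :=
    tendsto_pow_atTop_atTop_of_one_lt one_lt_two
  have hfloor := ((tendsto_nat_floor_mul_div_atTop (R := ℝ) (a := (t / T : ℝ))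
    (by positivity)).comp hpow).mul_const (T : ℝ)
  rw [div_mul_cancel₀ _ hT'] at hfloor
  rw [← NNReal.tendsto_coe]
  refine hfloor.congr fun n => ?_
  simp only [Function.comp_apply, dyad, dyadIndex]
  push_cast
  ring

lemma dyadIndex_le {T t : ℝ≥0} (hT : 0 < T) (ht : t ≤ T) (n : ℕ) : dyadIndex T t n ≤ 2 ^ n := by
  have h : (t / T : ℝ) ≤ 1 := (div_le_one (NNReal.coe_pos.2 hT)).2 ht
  refine Nat.floor_le_of_le ?_
  push_cast
  exact mul_le_of_le_one_left (by positivity) h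

lemma dyadIndex_succ (T t : ℝ≥0) (n : ℕ) :
    dyadIndex T t (n + 1) = 2 * dyadIndex T t n ∨
      dyadIndex T t (n + 1) = 2 * dyadIndex T t n + 1 := by
  have hdouble : (t / T : ℝ) * 2 ^ (n + 1) = 2 * ((t / T : ℝ) * 2 ^ n) := by ring
  have hlower : 2 * dyadIndex T t n ≤ dyadIndex T t (n + 1) := by
    refine Nat.le_floor ?_
    rw [hdouble]
    push_cast
    exact mul_le_mul_of_nonneg_left (Nat.floor_le (by positivity)) two_pos.le
  have hupper : dyadIndex T t (n + 1) < 2 * dyadIndex T t n + 2 := by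
    refine (Nat.floor_lt (by positivity)).2 ?_
    rw [hdouble, dyadIndex]
    push_cast
    linarith [Nat.lt_floor_add_one ((t / T : ℝ) * 2 ^ n)]
  omega

lemma dyadIndex_of_sub_le {T s t : ℝ≥0} {n : ℕ} (hst : s ≤ t)
    (h : (t - s : ℝ) / T ≤ (1 / 2) ^ n) :
    dyadIndex T t n = dyadIndex T s n ∨ dyadIndex T t n = dyadIndex T s n + 1 := by
  have hst' : (s / T : ℝ) ≤ t / T := div_le_div_of_nonneg_right hst T.coe_nonneg
  have hlower : dyadIndex T s n ≤ dyadIndex T t n :=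
    Nat.floor_le_floor (mul_le_mul_of_nonneg_right hst' (by positivity))
  have hupper : dyadIndex T t n < dyadIndex T s n + 2 := by
    refine (Nat.floor_lt (by positivity)).2 ?_
    have hscale := mul_le_mul_of_nonneg_right h (show (0 : ℝ) ≤ 2 ^ n by positivity)
    rw [← mul_pow, one_div_mul_cancel two_ne_zero, one_pow, sub_div] at hscale
    rw [dyadIndex]
    push_cast
    linarith [Nat.lt_floor_add_one ((s / T : ℝ) * 2 ^ n)]
  omega

variable {E : Type*} [PseudoMetricSpace E] {T s t : ℝ≥0} {f : ℝ≥0 → E} {K ρ : ℝ}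

lemma dist_dyad_dyadIndex_succ_le (hT : 0 < T) (ht : t ≤ T) (hK : 0 ≤ K) (hρ0 : 0 ≤ ρ)
    (hρ1 : ρ ≤ 1)
    (h : ∀ n, ∀ k < 2 ^ n, dist (f (dyad T n k)) (f (dyad T n (k + 1))) ≤ K * ρ ^ n) (n : ℕ) :
    dist (f (dyad T n (dyadIndex T t n))) (f (dyad T (n + 1) (dyadIndex T t (n + 1)))) ≤
      K * ρ ^ n := by
  rcases dyadIndex_succ T t n with heven | hodd
  · rw [heven, dyad_two_mul, dist_self]
    positivity
  · have hlt : 2 * dyadIndex T t n < 2 ^ (n + 1) := by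
      have := dyadIndex_le hT ht (n + 1)
      omega
    rw [hodd, ← dyad_two_mul T n]
    exact (h (n + 1) _ hlt).trans
      (mul_le_mul_of_nonneg_left (pow_le_pow_of_le_one hρ0 hρ1 n.le_succ) hK)

lemma dist_dyad_dyadIndex_le (hT : 0 < T) (ht : t ≤ T) (hf : Continuous f) (hK : 0 ≤ K)
    (hρ0 : 0 ≤ ρ) (hρ1 : ρ < 1)
    (h : ∀ n, ∀ k < 2 ^ n, dist (f (dyad T n k)) (f (dyad T n (k + 1))) ≤ K * ρ ^ n) (n : ℕ) :
    dist (f (dyad T n (dyadIndex T t n))) (f t) ≤ K * ρ ^ n / (1 - ρ) :=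
  dist_le_of_le_geometric_of_tendsto ρ K hρ1
    (dist_dyad_dyadIndex_succ_le hT ht hK hρ0 hρ1.le h)
    ((hf.tendsto t).comp (tendsto_dyad_dyadIndex hT t)) n

lemma dist_le_of_dyad (hT : 0 < T) (hst : s ≤ t) (ht : t ≤ T) (hf : Continuous f) (hK : 0 ≤ K)
    (hρ0 : 0 ≤ ρ) (hρ1 : ρ < 1)
    (h : ∀ n, ∀ k < 2 ^ n, dist (f (dyad T n k)) (f (dyad T n (k + 1))) ≤ K * ρ ^ n) {n : ℕ}
    (hn : (t - s : ℝ) / T ≤ (1 / 2) ^ n) :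
    dist (f s) (f t) ≤ K * ρ ^ n * (1 + 2 / (1 - ρ)) := by
  have hs := dist_dyad_dyadIndex_le hT (hst.trans ht) hf hK hρ0 hρ1 h n
  have ht' := dist_dyad_dyadIndex_le hT ht hf hK hρ0 hρ1 h n
  have hmid : dist (f (dyad T n (dyadIndex T s n))) (f (dyad T n (dyadIndex T t n))) ≤
      K * ρ ^ n := by
    rcases dyadIndex_of_sub_le hst hn with heq | hsucc
    · rw [heq, dist_self]
      positivity
    · have := dyadIndex_le hT ht n
      rw [hsucc]
      exact h n _ (by omega)
  rw [dist_comm] at hs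
  calc dist (f s) (f t) ≤ K * ρ ^ n / (1 - ρ) + K * ρ ^ n + K * ρ ^ n / (1 - ρ) :=
        (dist_triangle4 _ _ _ _).trans (by gcongr)
    _ = K * ρ ^ n * (1 + 2 / (1 - ρ)) := by ring

lemma holderOnWith_Iic_of_dist_le {C γ : ℝ≥0}
    (h : ∀ s t, s < t → t ≤ T → dist (f s) (f t) ≤ C * ((t : ℝ) - s) ^ (γ : ℝ)) :
    HolderOnWith C γ f (Set.Iic T) := by
  have hlt : ∀ s t, s < t → t ≤ T → edist (f s) (f t) ≤ C * edist s t ^ (γ : ℝ) := by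
    intro s t hst ht
    have hdist : dist s t = (t : ℝ) - s := by
      rw [dist_comm, NNReal.dist_eq, abs_of_pos (sub_pos.2 (NNReal.coe_lt_coe.2 hst))]
    rw [edist_dist, edist_dist, ENNReal.ofReal_rpow_of_nonneg dist_nonneg γ.coe_nonneg,
      ← ENNReal.ofReal_coe_nnreal, ← ENNReal.ofReal_mul C.coe_nonneg, hdist]
    exact ENNReal.ofReal_le_ofReal (h s t hst ht)
  intro s hs t ht
  rcases lt_trichotomy s t with hst | rfl | hts
  · exact hlt s t hst ht
  · simp
  · rw [edist_comm, edist_comm s]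
    exact hlt t s hts hs

lemma exists_holderOnWith_of_dyad (E : Type*) [PseudoMetricSpace E] {γ : ℝ≥0} (hT : 0 < T)
    (hγ : 0 < γ) :
    ∃ C : ℝ≥0, 1 ≤ C ∧ ∀ (K : ℝ≥0) (f : ℝ≥0 → E), Continuous f →
      (∀ n, ∀ k < 2 ^ n, dist (f (dyad T n k)) (f (dyad T n (k + 1))) ≤
        K * ((1 / 2 : ℝ) ^ (γ : ℝ)) ^ n) →
      HolderOnWith (C * K) γ f (Set.Iic T) := by
  have hT' : (0 : ℝ) < T := hT
  set ρ : ℝ := (1 / 2 : ℝ) ^ (γ : ℝ)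
  have hρ0 : 0 ≤ ρ := by positivity
  have hρ1 : ρ < 1 := Real.rpow_lt_one (by norm_num) (by norm_num) hγ
  set c : ℝ := (2 / T) ^ (γ : ℝ) * (1 + 2 / (1 - ρ))
  refine ⟨max 1 c.toNNReal, le_max_left _ _, fun K f hf h =>
    holderOnWith_Iic_of_dist_le fun s t hst ht => ?_⟩
  have hst' : (0 : ℝ) < t - s := sub_pos.2 hst
  have hle : ((t : ℝ) - s) / T ≤ 1 := by
    rw [div_le_one hT']
    linarith [s.coe_nonneg, NNReal.coe_le_coe.2 ht]
  obtain ⟨n, hn_lt, hn_le⟩ := exists_nat_pow_near_of_lt_one (div_pos hst' hT') hle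
    (show (0 : ℝ) < 1 / 2 by norm_num) (by norm_num)
  have hρn : ρ ^ n ≤ (2 / T) ^ (γ : ℝ) * ((t : ℝ) - s) ^ (γ : ℝ) := by
    rw [Real.rpow_pow_comm (by norm_num), ← Real.mul_rpow (by positivity) hst'.le]
    refine Real.rpow_le_rpow (by positivity) ?_ γ.coe_nonneg
    rw [pow_succ] at hn_lt
    rw [div_mul_eq_mul_div, mul_div_assoc]
    linarith
  have : 0 ≤ 1 + 2 / (1 - ρ) :=
    add_nonneg zero_le_one (div_nonneg zero_le_two (sub_nonneg.2 hρ1.le))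
  calc dist (f s) (f t) ≤ K * ρ ^ n * (1 + 2 / (1 - ρ)) :=
        dist_le_of_dyad hT hst.le ht hf K.coe_nonneg hρ0 hρ1 h hn_le
    _ ≤ K * ((2 / T) ^ (γ : ℝ) * ((t : ℝ) - s) ^ (γ : ℝ)) * (1 + 2 / (1 - ρ)) := by gcongr
    _ = c * K * ((t : ℝ) - s) ^ (γ : ℝ) := by ring
    _ ≤ (max 1 c.toNNReal * K : ℝ≥0) * ((t : ℝ) - s) ^ (γ : ℝ) := by
        push_cast
        gcongr
        exact (Real.le_coe_toNNReal c).trans (le_max_right _ _)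

end Chaining

/-! ### Moments of the Hölder constant of a Kolmogorov process -/

section Kolmogorov

variable {E : Type*} [PseudoMetricSpace E] {T γ L : ℝ≥0} {p q : ℝ}

/-- The weighted sum `1 + ∑ₙ ∑ₖ (2 ^ (γ n) |f (t (k + 1)) - f (t k)|) ^ p` over the dyadic
increments of `f` on `[0, T]`. Up to a constant, its `p`-th root is a `γ`-Hölder constant of `f`;
the summand `1` keeps that constant at least `1`. -/
noncomputable def dyadSum (T γ : ℝ≥0) (p : ℝ) (f : ℝ≥0 → E) : ℝ≥0∞ :=
  1 + ∑' n : ℕ, ∑ k ∈ Finset.range (2 ^ n),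
    (((2 : ℝ≥0∞) ^ (γ : ℝ)) ^ n * edist (f (dyad T n k)) (f (dyad T n (k + 1)))) ^ p

lemma dist_dyad_le_of_dyadSum {f : ℝ≥0 → E} (hp : 0 < p) (hsum : dyadSum T γ p f ≠ ∞) {n k : ℕ}
    (hk : k < 2 ^ n) :
    dist (f (dyad T n k)) (f (dyad T n (k + 1))) ≤
      ((dyadSum T γ p f).toNNReal ^ p⁻¹ : ℝ≥0) * ((1 / 2 : ℝ) ^ (γ : ℝ)) ^ n := by
  have hterm : (((2 : ℝ≥0∞) ^ (γ : ℝ)) ^ n *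
      edist (f (dyad T n k)) (f (dyad T n (k + 1)))) ^ p ≤ dyadSum T γ p f :=
    (Finset.single_le_sum (f := fun k => (((2 : ℝ≥0∞) ^ (γ : ℝ)) ^ n *
      edist (f (dyad T n k)) (f (dyad T n (k + 1)))) ^ p) (fun _ _ => zero_le)
      (Finset.mem_range.2 hk)).trans ((ENNReal.le_tsum n).trans le_add_self)
  rw [← ENNReal.le_rpow_inv_iff hp, edist_nndist, ← ENNReal.coe_toNNReal hsum,
    ← ENNReal.coe_rpow_of_nonneg _ (inv_nonneg.2 hp.le), ← ENNReal.coe_ofNat,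
    ← ENNReal.coe_rpow_of_nonneg _ γ.coe_nonneg, ← ENNReal.coe_pow, ← ENNReal.coe_mul,
    ENNReal.coe_le_coe, ← NNReal.coe_le_coe] at hterm
  push_cast at hterm ⊢
  have hpow : (0 : ℝ) < (2 ^ (γ : ℝ)) ^ n := by positivity
  rwa [Real.div_rpow zero_le_one two_pos.le, Real.one_rpow, div_pow, one_pow, mul_one_div,
    le_div_iff₀' hpow]

lemma edist_dyad_succ (T : ℝ≥0) (n k : ℕ) :
    edist (dyad T n k) (dyad T n (k + 1)) = T / 2 ^ n := by
  have hdist : nndist (dyad T n k) (dyad T n (k + 1)) = T / 2 ^ n := by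
    ext
    rw [coe_nndist, dist_comm, NNReal.dist_eq, dyad, dyad]
    push_cast
    rw [← sub_div, ← sub_mul, add_sub_cancel_left, one_mul, abs_of_nonneg (by positivity)]
  rw [edist_nndist, hdist, ENNReal.coe_div (by positivity)]
  simp

variable {Ω : Type*} [MeasurableSpace Ω] {P : Measure Ω} {X : ℝ≥0 → Ω → E}

lemma aemeasurable_dyadSum (hX : IsAEKolmogorovProcess X P p q L) (T γ : ℝ≥0) :
    AEMeasurable (fun ω => dyadSum T γ p (X · ω)) P :=
  aemeasurable_const.add <| AEMeasurable.tsum fun _ => Finset.aemeasurable_fun_sum _ fun _ _ =>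
    (hX.aemeasurable_edist.const_mul _).pow_const _

lemma lintegral_dyadTerm_le (hX : IsAEKolmogorovProcess X P p q L) (T γ : ℝ≥0) (n k : ℕ) :
    ∫⁻ ω, (((2 : ℝ≥0∞) ^ (γ : ℝ)) ^ n *
        edist (X (dyad T n k) ω) (X (dyad T n (k + 1)) ω)) ^ p ∂P ≤
      L * (T : ℝ≥0∞) ^ q * (2 ^ (γ * p - q)) ^ n := by
  have hp := hX.p_pos.le
  simp_rw [ENNReal.mul_rpow_of_nonneg _ _ hp]
  rw [lintegral_const_mul'' _ (hX.aemeasurable_edist.pow_const p)]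
  refine (mul_le_mul_right (hX.kolmogorovCondition _ _) _).trans_eq ?_
  rw [edist_dyad_succ, ENNReal.div_rpow_of_nonneg _ _ hX.q_pos.le, div_eq_mul_inv,
    ← ENNReal.rpow_neg, mul_left_comm, mul_left_comm _ ((T : ℝ≥0∞) ^ q), mul_assoc (L : ℝ≥0∞)]
  simp only [← ENNReal.rpow_natCast, ← ENNReal.rpow_mul]
  rw [← ENNReal.rpow_add _ _ two_ne_zero ENNReal.ofNat_ne_top]
  congr 3
  ring

lemma lintegral_dyadSum_le [IsProbabilityMeasure P] (hX : IsAEKolmogorovProcess X P p q L)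
    (T γ : ℝ≥0) :
    ∫⁻ ω, dyadSum T γ p (X · ω) ∂P ≤
      1 + L * (T : ℝ≥0∞) ^ q * ∑' n : ℕ, ((2 : ℝ≥0∞) ^ (1 + (γ * p - q))) ^ n := by
  have hmeas (n k : ℕ) : AEMeasurable (fun ω => (((2 : ℝ≥0∞) ^ (γ : ℝ)) ^ n *
      edist (X (dyad T n k) ω) (X (dyad T n (k + 1)) ω)) ^ p) P :=
    (hX.aemeasurable_edist.const_mul _).pow_const _
  simp only [dyadSum]
  rw [lintegral_add_left measurable_const, lintegral_const, measure_univ, mul_one,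
    lintegral_tsum fun n => Finset.aemeasurable_fun_sum _ fun k _ => hmeas n k,
    ← ENNReal.tsum_mul_left]
  gcongr with n
  rw [lintegral_finsetSum' _ fun k _ => hmeas n k]
  refine (Finset.sum_le_card_nsmul _ _ _ fun k _ => lintegral_dyadTerm_le hX T γ n k).trans_eq ?_
  rw [Finset.card_range, nsmul_eq_mul, ENNReal.rpow_add _ _ two_ne_zero ENNReal.ofNat_ne_top,
    ENNReal.rpow_one, mul_pow]
  push_cast
  ring

lemma exists_holderOnWith_of_isAEKolmogorovProcess (E : Type*) [PseudoMetricSpace E] (L : ℝ≥0)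
    (hT : 0 < T) (hγ : 0 < γ) (hp : 0 < p) (hγp : γ * p < q - 1) :
    ∃ D : ℝ≥0∞, D ≠ ∞ ∧ ∀ (Ω : Type*) [MeasurableSpace Ω] (P : Measure Ω)
      [IsProbabilityMeasure P] (X : ℝ≥0 → Ω → E), IsAEKolmogorovProcess X P p q L →
      (∀ᵐ ω ∂P, Continuous (X · ω)) →
      ∃ M : Ω → ℝ≥0, AEMeasurable M P ∧ ∫⁻ ω, (M ω : ℝ≥0∞) ^ p ∂P ≤ D ∧
        ∀ᵐ ω ∂P, 1 ≤ M ω ∧ HolderOnWith (M ω) γ (X · ω) (Set.Iic T) := by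
  obtain ⟨C, hC, hholder⟩ := exists_holderOnWith_of_dyad E hT hγ
  set S := 1 + L * (T : ℝ≥0∞) ^ q * ∑' n : ℕ, ((2 : ℝ≥0∞) ^ (1 + (γ * p - q))) ^ n
  have hS : S ≠ ∞ := by
    have hratio : (2 : ℝ≥0∞) ^ (1 + (γ * p - q)) < 1 :=
      ENNReal.rpow_lt_one_of_one_lt_of_neg ENNReal.one_lt_two (by linarith)
    have hgeom := ENNReal.inv_ne_top.2 (tsub_pos_of_lt hratio).ne'
    rw [← ENNReal.tsum_geometric] at hgeom
    have hTq : (T : ℝ≥0∞) ^ q ≠ ∞ :=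
      ENNReal.rpow_ne_top_of_ne_zero (ENNReal.coe_ne_zero.2 hT.ne') ENNReal.coe_ne_top
    finiteness
  refine ⟨C ^ p * S, ENNReal.mul_ne_top (by finiteness) hS, fun Ω _ P _ X hX hcont => ?_⟩
  have hmean := lintegral_dyadSum_le hX T γ
  have hmeas := aemeasurable_dyadSum hX T γ
  refine ⟨fun ω => C * (dyadSum T γ p (X · ω)).toNNReal ^ p⁻¹, by fun_prop, ?_, ?_⟩
  · refine le_trans ?_ (mul_le_mul_right hmean _)
    rw [← lintegral_const_mul'' _ hmeas]
    refine lintegral_mono fun ω => ?_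
    rw [ENNReal.coe_mul, ENNReal.mul_rpow_of_nonneg _ _ hp.le,
      ENNReal.coe_rpow_of_nonneg _ (inv_nonneg.2 hp.le), ENNReal.rpow_inv_rpow hp.ne']
    gcongr
    exact ENNReal.coe_toNNReal_le_self
  · filter_upwards [hcont, ae_lt_top' hmeas (ne_top_of_le_ne_top hS hmean)] with ω hω hfin
    have hone : 1 ≤ (dyadSum T γ p (X · ω)).toNNReal := by
      rw [← ENNReal.coe_le_coe, ENNReal.coe_toNNReal hfin.ne]
      exact le_self_add
    exact ⟨one_le_mul hC (NNReal.one_le_rpow hone (inv_nonneg.2 hp.le)),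
      hholder _ _ hω fun n k hk => dist_dyad_le_of_dyadSum hp hfin.ne hk⟩

end Kolmogorov

/-! ### Brownian motion -/

section Brownian

variable {Ω : Type*} [MeasurableSpace Ω] {P : Measure Ω} {B : ℝ≥0 → Ω → ℝ}

/-- The absolute moment of order `p` of the standard Gaussian law. -/
noncomputable def gaussianAbsMoment (p : ℝ) : ℝ≥0 :=
  (∫⁻ x, ‖x‖ₑ ^ p ∂(gaussianReal 0 1)).toNNReal

lemma lintegral_enorm_rpow_gaussianReal {p : ℝ} (hp : 0 < p) (v : ℝ≥0) :
    ∫⁻ x, ‖x‖ₑ ^ p ∂(gaussianReal 0 v) = gaussianAbsMoment p * (v : ℝ≥0∞) ^ (p / 2) := by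
  have hfin : ∫⁻ x, ‖x‖ₑ ^ p ∂(gaussianReal 0 1) ≠ ∞ := by
    have h := (memLp_id_gaussianReal (μ := 0) (v := 1) p.toNNReal).eLpNorm_lt_top
    rw [eLpNorm_lt_top_iff_lintegral_rpow_enorm_lt_top (by simpa using hp) (by simp)] at h
    simpa [Real.coe_toNNReal _ hp.le] using h.ne
  have hscale : gaussianReal 0 v = (gaussianReal 0 1).map ((NNReal.sqrt v : ℝ) * ·) := by
    rw [gaussianReal_map_const_mul]
    congr 1
    · simp
    · ext
      simp
  rw [hscale, lintegral_map (by fun_prop) (by fun_prop), gaussianAbsMoment,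
    ENNReal.coe_toNNReal hfin, ← lintegral_mul_const _ (by fun_prop)]
  refine lintegral_congr fun x => ?_
  have hsqrt : ‖(NNReal.sqrt v : ℝ)‖ₑ = (v : ℝ≥0∞) ^ (1 / 2 : ℝ) := by
    rw [← ofReal_norm, Real.norm_of_nonneg (NNReal.coe_nonneg _), ENNReal.ofReal_coe_nnreal,
      NNReal.sqrt_eq_rpow, ENNReal.coe_rpow_of_nonneg _ (by norm_num)]
  rw [enorm_mul, ENNReal.mul_rpow_of_nonneg _ _ hp.le, hsqrt, ← ENNReal.rpow_mul, mul_comm,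
    one_div_mul_eq_div]

lemma isAEKolmogorovProcess_of_isPreBrownianReal (hB : IsPreBrownianReal B P) {p : ℝ}
    (hp : 0 < p) : IsAEKolmogorovProcess B P p (p / 2) (gaussianAbsMoment p) := by
  refine ⟨fun t => (hB.aemeasurable t).mk, .mk_of_secondCountableTopology
    (fun t => (hB.aemeasurable t).measurable_mk) (fun s t => ?_) hp (half_pos hp),
    fun t => (hB.aemeasurable t).ae_eq_mk⟩
  calc ∫⁻ ω, edist ((hB.aemeasurable s).mk (B s) ω) ((hB.aemeasurable t).mk (B t) ω) ^ p ∂P =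
        ∫⁻ ω, ‖(B s - B t) ω‖ₑ ^ p ∂P := by
        refine lintegral_congr_ae ?_
        filter_upwards [(hB.aemeasurable s).ae_eq_mk, (hB.aemeasurable t).ae_eq_mk] with ω hs ht
        rw [← hs, ← ht, edist_eq_enorm_sub, Pi.sub_apply]
    _ = ∫⁻ x, ‖x‖ₑ ^ p ∂(gaussianReal 0 (nndist s t)) :=
        (hB.hasLaw_sub s t).lintegral_comp (f := fun x => ‖x‖ₑ ^ p) (by fun_prop)
    _ ≤ gaussianAbsMoment p * edist s t ^ (p / 2) := by
        rw [lintegral_enorm_rpow_gaussianReal hp, edist_nndist]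

lemma exists_holderOnWith_of_isBrownianReal {γ T : ℝ≥0} (hT : 0 < T) (hγ : 0 < γ)
    (hγ2 : (γ : ℝ) < 1 / 2) (q : ℝ) :
    ∃ D : ℝ≥0∞, D ≠ ∞ ∧ ∀ (Ω : Type*) [MeasurableSpace Ω] (P : Measure Ω)
      [IsProbabilityMeasure P] (B : ℝ≥0 → Ω → ℝ), IsBrownianReal B P →
      ∃ M : Ω → ℝ≥0, AEMeasurable M P ∧ ∫⁻ ω, (M ω : ℝ≥0∞) ^ q ∂P ≤ D ∧
        ∀ᵐ ω ∂P, 1 ≤ M ω ∧ HolderOnWith (M ω) γ (B · ω) (Set.Iic T) := by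
  have hγ' : 0 < 1 / 2 - (γ : ℝ) := sub_pos.2 hγ2
  set p := max q (2 / (1 / 2 - γ))
  have hp : 2 ≤ p * (1 / 2 - γ) := (div_le_iff₀ hγ').1 (le_max_right _ _)
  have hp0 : 0 < p := lt_max_of_lt_right (by positivity)
  obtain ⟨D, hD, hholder⟩ := exists_holderOnWith_of_isAEKolmogorovProcess (p := p) (q := p / 2) ℝ
    (gaussianAbsMoment p) hT hγ hp0 (by linarith)
  refine ⟨D, hD, fun Ω _ P _ B hB => ?_⟩
  obtain ⟨M, hM, hmoment, hae⟩ := hholder Ω P B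
    (isAEKolmogorovProcess_of_isPreBrownianReal hB.toIsPreBrownianReal hp0) hB.cont
  refine ⟨M, hM, (lintegral_mono_ae ?_).trans hmoment, hae⟩
  filter_upwards [hae] with ω hω
  exact ENNReal.rpow_le_rpow_of_exponent_le (ENNReal.one_le_coe_iff.2 hω.1) (le_max_left _ _)

/-! ### Long gaps between the embedded times -/

lemma gaussianReal_le_volume (μ : ℝ) {v : ℝ≥0} (hv : v ≠ 0) (s : Set ℝ) :
    gaussianReal μ v s ≤ ENNReal.ofReal (√(2 * Real.pi * v))⁻¹ * volume s := by
  rw [gaussianReal_apply μ hv, ← setLIntegral_const]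
  refine lintegral_mono fun x => ENNReal.ofReal_le_ofReal ?_
  refine mul_le_of_le_one_right (by positivity) (Real.exp_le_one_iff.2 ?_)
  exact div_nonpos_of_nonpos_of_nonneg (neg_nonpos.2 (sq_nonneg _)) (by positivity)

lemma measure_abs_sub_le_le (hB : IsPreBrownianReal B P) {s t : ℝ≥0} (hst : s < t) (δ : ℝ) :
    P {ω | |B t ω - B s ω| ≤ δ} ≤ ENNReal.ofReal (δ / √(t - s)) := by
  have hpos : (0 : ℝ) < t - s := sub_pos.2 hst
  have hvar : ((nndist t s : ℝ≥0) : ℝ) = t - s := by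
    rw [coe_nndist, NNReal.dist_eq, abs_of_pos hpos]
  have hv : nndist t s ≠ 0 := by
    rw [← NNReal.coe_ne_zero, hvar]
    exact hpos.ne'
  have hlaw : P {ω | |B t ω - B s ω| ≤ δ} = gaussianReal 0 (nndist t s) {x | |x| ≤ δ} :=
    (hB.hasLaw_sub t s).measure_eq (p := fun x => |x| ≤ δ)
      (measurableSet_le (by fun_prop) measurable_const)
  have hset : {x : ℝ | |x| ≤ δ} = Set.Icc (-δ) δ := by
    ext
    simp [abs_le]
  have hsqrt : 2 * √(t - s : ℝ) ≤ √(2 * Real.pi * (t - s)) := by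
    rw [Real.sqrt_mul (by positivity)]
    gcongr
    exact Real.le_sqrt_of_sq_le (by linarith [Real.pi_gt_three])
  rw [hlaw, hset]
  refine (gaussianReal_le_volume 0 hv _).trans ?_
  rw [Real.volume_Icc, ← ENNReal.ofReal_mul (by positivity), hvar]
  rcases le_or_gt 0 δ with hδ | hδ
  · refine ENNReal.ofReal_le_ofReal ?_
    calc (√(2 * Real.pi * (t - s)))⁻¹ * (δ - -δ) ≤ (2 * √(t - s : ℝ))⁻¹ * (δ - -δ) := by
          gcongr
          linarith
      _ = δ / √(t - s) := by field_simp; ring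
  · rw [ENNReal.ofReal_of_nonpos (mul_nonpos_of_nonneg_of_nonpos (by positivity) (by linarith))]
    exact zero_le

/-- The event that one of the `n` blocks of `m` consecutive steps of the grid `h ℕ` has all its
increments bounded by `δ`. -/
def stuckSet (X : ℝ≥0 → Ω → ℝ) (h : ℝ≥0) (δ : ℝ) (n m : ℕ) : Set Ω :=
  ⋃ j ∈ Finset.range n, ⋂ l ∈ Finset.Ico (j * m) (j * m + m),
    {ω | |X ((l + 1 : ℕ) * h) ω - X (l * h) ω| ≤ δ}

lemma measure_stuckSet_le (hB : IsPreBrownianReal B P) {h : ℝ≥0} (hh : 0 < h) (δ : ℝ) (n m : ℕ) :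
    P (stuckSet B h δ n m) ≤ n * ENNReal.ofReal (δ / √h) ^ m := by
  have hmono : Monotone fun l : ℕ => (l : ℝ≥0) * h := fun a b hab => by
    dsimp only
    gcongr
  have hstep (l : ℕ) : P {ω | |B ((l + 1 : ℕ) * h) ω - B (l * h) ω| ≤ δ} ≤
      ENNReal.ofReal (δ / √h) := by
    have hlt : (l : ℝ≥0) * h < (l + 1 : ℕ) * h :=
      mul_lt_mul_of_pos_right (Nat.cast_lt.2 l.lt_succ_self) hh
    refine (measure_abs_sub_le_le hB hlt δ).trans_eq ?_
    push_cast
    rw [← sub_mul, add_sub_cancel_left, one_mul]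
  have hblock (j : ℕ) : P (⋂ l ∈ Finset.Ico (j * m) (j * m + m),
      {ω | |B ((l + 1 : ℕ) * h) ω - B (l * h) ω| ≤ δ}) ≤ ENNReal.ofReal (δ / √h) ^ m := by
    have hind := (hB.hasIndepIncrements.nat hmono).measure_inter_preimage_eq_mul
      (Finset.Ico (j * m) (j * m + m)) (sets := fun _ => {x | |x| ≤ δ})
      (fun _ _ => measurableSet_le (by fun_prop) measurable_const)
    refine hind.trans_le ((Finset.prod_le_pow_card _ _ _ fun l _ => hstep l).trans_eq ?_)
    simp
  refine (measure_biUnion_finset_le _ _).trans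
    ((Finset.sum_le_card_nsmul _ _ _ fun j _ => hblock j).trans_eq ?_)
  rw [Finset.card_range, nsmul_eq_mul]

lemma sub_lastTime_le_of_notMem_stuckSet {Ω : Type*} {X : ℝ≥0 → Ω → ℝ} {h t : ℝ≥0} {ε : ℝ}
    {n m : ℕ} {ω : Ω} (hε : 0 < ε) (hh : 0 < h) (hm : 0 < m) (hc : Continuous (X · ω))
    (ht : t ≤ n * (m * h)) (hω : ω ∉ stuckSet X h (2 * ε) n m) :
    (t : ℝ) - lastTime (X · ω) ε t ≤ 2 * (m * h) := by
  by_contra! hgap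
  set τ := lastTime (X · ω) ε t
  set d : ℝ≥0 := m * h
  have hd : 0 < d := by positivity
  set j := ⌈τ / d⌉₊
  have hτj : τ ≤ j * d := (div_le_iff₀ hd).1 (Nat.le_ceil _)
  have hjt : (j + 1 : ℝ≥0) * d < t := by
    have hceil : (j : ℝ≥0) < τ / d + 1 := Nat.ceil_lt_add_one zero_le
    have hlt := mul_lt_mul_of_pos_right hceil hd
    rw [add_mul, div_mul_cancel₀ _ hd.ne'] at hlt
    rw [← NNReal.coe_lt_coe] at hlt ⊢
    push_cast [d] at hlt ⊢
    linarith
  have hjn : j < n := by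
    have hlt := lt_of_mul_lt_mul_right (hjt.trans_le ht) d.2
    exact (Nat.lt_succ_self j).trans (by exact_mod_cast hlt)
  have hgrid : ∀ l : ℕ, j * m ≤ l → l ≤ j * m + m → τ ≤ l * h ∧ l * h ≤ t := by
    intro l hjl hlj
    constructor
    · calc τ ≤ j * d := hτj
        _ = (j * m : ℕ) * h := by push_cast; ring
        _ ≤ l * h := by gcongr
    · calc (l : ℝ≥0) * h ≤ (j * m + m : ℕ) * h := by gcongr
        _ = (j + 1) * d := by push_cast; ring
        _ ≤ t := hjt.le
  simp only [stuckSet, Set.mem_iUnion, Set.mem_iInter] at hω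
  refine hω ⟨j, Finset.mem_range.2 hjn, fun l hl => ?_⟩
  rw [Finset.mem_Ico] at hl
  have hl₀ := hgrid l hl.1 hl.2.le
  have hl₁ := hgrid (l + 1) (hl.1.trans l.le_succ) hl.2
  have h₀ := abs_sub_lastTime_le hc hε hl₀.1 hl₀.2
  have h₁ := abs_sub_lastTime_le hc hε hl₁.1 hl₁.2
  rw [abs_sub_comm] at h₀
  exact (abs_sub_le _ _ _).trans ((add_le_add h₁ h₀).trans_eq (two_mul ε).symm)

lemma exists_measure_stuckSet_le {κ N : ℝ} {T : ℝ≥0} {m : ℕ} (hT : 0 < T) (hm : 0 < m)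
    (hκ : 0 ≤ κ) (hN : N + κ ≤ (1 - κ / 2) * m) :
    ∃ S : ℝ, ∀ (Ω : Type*) [MeasurableSpace Ω] (P : Measure Ω) (B : ℝ≥0 → Ω → ℝ),
      IsPreBrownianReal B P → ∀ ε > 0, ε ≤ 1 → ∀ h : ℝ≥0, (h : ℝ) = T / m * ε ^ κ →
        P (stuckSet B h (2 * ε) ⌈ε ^ (-κ)⌉₊ m) ≤ ENNReal.ofReal (S * ε ^ N) := by
  set c := 2 / √(T / m : ℝ)
  refine ⟨2 * c ^ m, fun Ω _ P B hB ε hε hε1 h hh => ?_⟩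
  have hh0 : 0 < h := by
    rw [← NNReal.coe_pos, hh]
    positivity
  have hblocks : (⌈ε ^ (-κ)⌉₊ : ℝ) ≤ 2 * ε ^ (-κ) := by
    have hone := Real.one_le_rpow_of_pos_of_le_one_of_nonpos hε hε1 (neg_nonpos.2 hκ)
    linarith [Nat.ceil_lt_add_one (zero_le_one.trans hone)]
  have hstep : 2 * ε / √h = c * ε ^ (1 - κ / 2) := by
    rw [hh, Real.sqrt_mul (by positivity), Real.sqrt_eq_rpow (ε ^ κ), ← Real.rpow_mul hε.le,
      Real.rpow_sub hε, Real.rpow_one, mul_one_div]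
    ring
  refine (measure_stuckSet_le hB hh0 _ _ _).trans ?_
  rw [← ENNReal.ofReal_natCast, ← ENNReal.ofReal_pow (by positivity),
    ← ENNReal.ofReal_mul (by positivity)]
  refine ENNReal.ofReal_le_ofReal ?_
  calc (⌈ε ^ (-κ)⌉₊ : ℝ) * (2 * ε / √h) ^ m ≤ 2 * ε ^ (-κ) * (c * ε ^ (1 - κ / 2)) ^ m := by
        rw [hstep]
        gcongr
    _ = 2 * c ^ m * ε ^ (-κ + (1 - κ / 2) * m) := by
        rw [mul_pow, ← Real.rpow_natCast (ε ^ _), ← Real.rpow_mul hε.le, Real.rpow_add hε]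
        ring
    _ ≤ 2 * c ^ m * ε ^ N := by
        gcongr ?_ * ?_
        exact Real.rpow_le_rpow_of_exponent_ge hε hε1 (by linarith)

lemma exists_measure_long_gap_le {κ : ℝ} {T : ℝ≥0} (hT : 0 < T) (hκ0 : 0 ≤ κ) (hκ2 : κ < 2)
    (N : ℝ) :
    ∃ S : ℝ, ∀ (Ω : Type*) [MeasurableSpace Ω] (P : Measure Ω) (B : ℝ≥0 → Ω → ℝ),
      IsPreBrownianReal B P → ∀ ε > 0, ∃ A : Set Ω, P A ≤ ENNReal.ofReal (S * ε ^ N) ∧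
        ∀ ω ∉ A, Continuous (B · ω) → ∀ t ≤ T,
          (t : ℝ) - lastTime (B · ω) ε t ≤ 2 * T * ε ^ κ := by
  have hκ : 0 < 1 - κ / 2 := by linarith
  obtain ⟨m, hm⟩ := exists_nat_ge (max 1 ((N + κ) / (1 - κ / 2)))
  have hm1 : (1 : ℝ) ≤ m := (le_max_left _ _).trans hm
  have hm0 : (0 : ℝ) < m := zero_lt_one.trans_le hm1
  have hmN : N + κ ≤ (1 - κ / 2) * m := (div_le_iff₀' hκ).1 ((le_max_right _ _).trans hm)
  obtain ⟨S, hS⟩ := exists_measure_stuckSet_le hT (Nat.cast_pos.1 hm0) hκ0 hmN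
  refine ⟨S, fun Ω _ P B hB ε hε => ?_⟩
  rcases le_total ε 1 with hε1 | hε1
  · set h : ℝ≥0 := T / m * ε.toNNReal ^ κ
    have hh : (h : ℝ) = T / m * ε ^ κ := by simp [h, Real.coe_toNNReal _ hε.le]
    have hmh : (m : ℝ) * h = T * ε ^ κ := by
      rw [hh, ← mul_assoc, mul_div_cancel₀ _ hm0.ne']
    have hh0 : 0 < h := by
      rw [← NNReal.coe_pos, hh]
      positivity
    refine ⟨_, hS Ω P B hB ε hε hε1 h hh, fun ω hω hc t ht => ?_⟩
    have hcover : t ≤ ⌈ε ^ (-κ)⌉₊ * (m * h) := by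
      rw [← NNReal.coe_le_coe]
      push_cast
      rw [hmh]
      calc (t : ℝ) ≤ ε ^ (-κ) * (T * ε ^ κ) := by
            rw [mul_left_comm, ← Real.rpow_add hε, neg_add_cancel, Real.rpow_zero, mul_one]
            exact ht
        _ ≤ ⌈ε ^ (-κ)⌉₊ * (T * ε ^ κ) := by gcongr; exact Nat.le_ceil _
    refine (sub_lastTime_le_of_notMem_stuckSet hε hh0 (Nat.cast_pos.1 hm0) hc hcover
      hω).trans_eq ?_
    rw [hmh, mul_assoc]
  · refine ⟨∅, by simp, fun ω _ _ t ht => ?_⟩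
    calc (t : ℝ) - lastTime (B · ω) ε t ≤ T := (sub_le_self _ (NNReal.coe_nonneg _)).trans ht
      _ ≤ T * (2 * ε ^ κ) := le_mul_of_one_le_right T.coe_nonneg
          (by linarith [Real.one_le_rpow hε1 hκ0])
      _ = 2 * T * ε ^ κ := by ring

end Brownian

/-! ### The moment estimate -/

section Moments

variable {Ω : Type*} [MeasurableSpace Ω] {P : Measure Ω} {X Y : Ω → ℝ≥0∞} {p : ℝ}

lemma setLIntegral_rpow_le_sqrt (hY : AEMeasurable Y P) (p : ℝ) (A : Set Ω) :
    ∫⁻ ω in A, Y ω ^ p ∂P ≤ (∫⁻ ω, Y ω ^ (2 * p) ∂P) ^ (1 / 2 : ℝ) * P A ^ (1 / 2 : ℝ) := by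
  have hcs := ENNReal.lintegral_mul_le_Lp_mul_Lq (P.restrict A) Real.HolderConjugate.two_two
    (hY.restrict.pow_const p) (g := 1) aemeasurable_const
  simp only [Pi.mul_apply, Pi.one_apply, mul_one, ENNReal.one_rpow, setLIntegral_one,
    ← ENNReal.rpow_mul, mul_comm p 2] at hcs
  exact hcs.trans (by gcongr; exact Measure.restrict_le_self)

lemma lintegral_rpow_le_of_exceptional [IsProbabilityMeasure P] (hY : AEMeasurable Y P)
    (hp : 0 ≤ p) {e : ℝ≥0∞} {A : Set Ω} (hX : ∀ᵐ ω ∂P, X ω ≤ Y ω * max e 1)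
    (hXA : ∀ᵐ ω ∂P, ω ∉ A → X ω ≤ Y ω * e) :
    ∫⁻ ω, X ω ^ p ∂P ≤
      (∫⁻ ω, Y ω ^ (2 * p) ∂P) ^ (1 / 2 : ℝ) * (e ^ p + P A ^ (1 / 2 : ℝ)) := by
  have hpoint : ∀ᵐ ω ∂P, X ω ^ p ≤ Y ω ^ p * e ^ p + A.indicator (fun ω => Y ω ^ p) ω := by
    filter_upwards [hX, hXA] with ω hω hωA
    by_cases hmem : ω ∈ A
    · have hmax : max e 1 ^ p ≤ e ^ p + 1 := by
        rw [(ENNReal.monotone_rpow_of_nonneg hp).map_max, ENNReal.one_rpow]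
        exact max_le_add_of_nonneg zero_le zero_le
      rw [Set.indicator_of_mem hmem]
      calc X ω ^ p ≤ (Y ω * max e 1) ^ p := ENNReal.rpow_le_rpow hω hp
        _ ≤ Y ω ^ p * (e ^ p + 1) := by
            rw [ENNReal.mul_rpow_of_nonneg _ _ hp]
            gcongr
        _ = Y ω ^ p * e ^ p + Y ω ^ p := by rw [mul_add, mul_one]
    · rw [Set.indicator_of_notMem hmem, add_zero, ← ENNReal.mul_rpow_of_nonneg _ _ hp]
      exact ENNReal.rpow_le_rpow (hωA hmem) hp
  have hall := setLIntegral_rpow_le_sqrt hY p Set.univ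
  rw [Measure.restrict_univ, measure_univ, ENNReal.one_rpow, mul_one] at hall
  calc ∫⁻ ω, X ω ^ p ∂P ≤ ∫⁻ ω, (Y ω ^ p * e ^ p + A.indicator (fun ω => Y ω ^ p) ω) ∂P :=
        lintegral_mono_ae hpoint
    _ = (∫⁻ ω, Y ω ^ p ∂P) * e ^ p + ∫⁻ ω, A.indicator (fun ω => Y ω ^ p) ω ∂P := by
        rw [lintegral_add_left' ((hY.pow_const p).mul_const _),
          lintegral_mul_const'' _ (hY.pow_const p)]
    _ ≤ _ := by
        rw [mul_add]
        exact add_le_add (mul_le_mul_left hall _)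
          ((lintegral_indicator_le _ _).trans (setLIntegral_rpow_le_sqrt hY p A))

end Moments

lemma exists_supNorm_approx_sub_Lam_le {H η : ℝ} {γ : ℝ≥0} (hH0 : 0 < H) (hH : H < 1 / 2)
    (hη0 : 0 ≤ η) (hη1 : η ≤ 1) (hγη : 1 / 2 - H < γ * (1 - η)) (hγH : 1 / 2 - H < γ * (1 - H))
    (hγ1 : γ ≤ 1) (T : ℝ≥0) :
    ∃ D : ℝ≥0, ∀ (K : ℝ≥0) (f : ℝ≥0 → ℝ), 1 ≤ K → Continuous f → f 0 = 0 →
      HolderOnWith K γ f (Set.Iic T) → ∀ ε > 0, ∀ d ≥ 0,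
        (∀ t ≤ T, (t : ℝ) - lastTime f ε t ≤ 2 * T * d) →
        supNorm T (fun t => approx H T f ε t - Lam H f t) ≤
          D * K * ENNReal.ofReal (max (ε ^ η) (d ^ (γ * H))) := by
  obtain ⟨C, hC, hbound⟩ := exists_abs_approx_sub_Lam_le hH0 hH hη0 hη1 hγη hγH hγ1 T
  refine ⟨C.toNNReal * (1 + (2 * T) ^ (γ * H)), fun K f hK hc hf0 hf ε hε d hd hgap =>
    iSup₂_le fun t ht => ?_⟩
  rw [Real.enorm_eq_ofReal_abs, ← ENNReal.ofReal_coe_nnreal, ← ENNReal.ofReal_coe_nnreal,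
    ← ENNReal.ofReal_mul (by positivity), ← ENNReal.ofReal_mul (by positivity)]
  refine ENNReal.ofReal_le_ofReal ((hbound K f hK hc hf0 hf ε hε t ht).trans ?_)
  have hrpow : ((t : ℝ) - lastTime f ε t) ^ (γ * H) ≤ (2 * T : ℝ) ^ (γ * H) * d ^ (γ * H) := by
    rw [← Real.mul_rpow (by positivity) hd]
    exact Real.rpow_le_rpow (sub_nonneg.2 (lastTime_le f ε t)) (hgap t ht) (by positivity)
  calc C * K * (ε ^ η + ((t : ℝ) - lastTime f ε t) ^ (γ * H)) ≤
        C * K * (max (ε ^ η) (d ^ (γ * H)) +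
          (2 * T : ℝ) ^ (γ * H) * max (ε ^ η) (d ^ (γ * H))) := by
        gcongr
        · exact le_max_left _ _
        · exact hrpow.trans (by gcongr; exact le_max_right _ _)
    _ = _ := by
        push_cast [Real.coe_toNNReal C hC]
        ring

lemma exists_holder_exponent {H η : ℝ} (hH0 : 0 < H) (hH : H < 1 / 2) (hη0 : 0 ≤ η)
    (hηH : η < H) :
    ∃ γ : ℝ≥0, 0 < γ ∧ (γ : ℝ) < 1 / 2 ∧ 1 / 2 - H < γ * (1 - H) ∧ η < 2 * (γ * H) := by
  obtain ⟨γ, hγl, hγ2⟩ :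
      ∃ γ : ℝ, max ((1 / 2 - H) / (1 - H)) (η / (2 * H)) < γ ∧ γ < 1 / 2 := by
    refine exists_between (max_lt ?_ ?_)
    · rw [div_lt_iff₀ (by linarith)]
      linarith
    · rw [div_lt_iff₀ (by linarith)]
      linarith
  obtain ⟨hγH, hγη⟩ := max_lt_iff.1 hγl
  have hγ0 : 0 < γ := lt_of_le_of_lt (by positivity) hγη
  rw [div_lt_iff₀ (by linarith)] at hγH hγη
  lift γ to ℝ≥0 using hγ0.le
  exact ⟨γ, hγ0, hγ2, hγH, hγη.trans_eq (by ring)⟩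

lemma exists_supNorm_approx_sub_le_of_isBrownianReal {H η : ℝ} {T : ℝ≥0} (hH0 : 0 < H)
    (hH : H < 1 / 2) (hT : 0 < T) (hη0 : 0 ≤ η) (hηH : η < H) {q : ℝ} (hq : 0 ≤ q) (N : ℝ) :
    ∃ F : ℝ≥0∞, F ≠ ∞ ∧ ∃ S : ℝ, ∀ (Ω : Type*) [MeasurableSpace Ω] (P : Measure Ω)
      [IsProbabilityMeasure P] (B BH : ℝ≥0 → Ω → ℝ), IsBrownianReal B P →
      (∀ᵐ ω ∂P, ∀ t ≤ T, BH t ω = Lam H (fun s => B s ω) t) → ∀ ε > 0,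
      ∃ (Y : Ω → ℝ≥0∞) (A : Set Ω), AEMeasurable Y P ∧ ∫⁻ ω, Y ω ^ q ∂P ≤ F ∧
        P A ≤ ENNReal.ofReal (S * ε ^ N) ∧ ∀ᵐ ω ∂P,
          supNorm T (fun t => approx H T (fun s => B s ω) ε t - BH t ω) ≤
            Y ω * max (ENNReal.ofReal (ε ^ η)) 1 ∧
          (ω ∉ A → supNorm T (fun t => approx H T (fun s => B s ω) ε t - BH t ω) ≤
            Y ω * ENNReal.ofReal (ε ^ η)) := by
  obtain ⟨γ, hγ0, hγ2, hγH, hηγ⟩ := exists_holder_exponent hH0 hH hη0 hηH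
  have hγη : 1 / 2 - H < γ * (1 - η) := hγH.trans_le (by gcongr)
  have hγ1 : γ ≤ 1 := NNReal.coe_le_coe.1 (by push_cast; linarith)
  have hγH0 : 0 < γ * H := by positivity
  have hκ2 : η / (γ * H) < 2 := (div_lt_iff₀ hγH0).2 hηγ
  obtain ⟨D, hpath⟩ :=
    exists_supNorm_approx_sub_Lam_le hH0 hH hη0 (by linarith) hγη hγH hγ1 T
  obtain ⟨F, hF, hholder⟩ := exists_holderOnWith_of_isBrownianReal hT hγ0 hγ2 q
  obtain ⟨S, hgaps⟩ := exists_measure_long_gap_le hT (by positivity) hκ2 N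
  refine ⟨D ^ q * F, by finiteness, S, fun Ω _ P _ B BH hB hBH ε hε => ?_⟩
  obtain ⟨M, hM, hMF, hMB⟩ := hholder Ω P B hB
  obtain ⟨A, hA, hgap⟩ := hgaps Ω P B hB.toIsPreBrownianReal ε hε
  refine ⟨fun ω => D * M ω, A, by fun_prop, ?_, hA, ?_⟩
  · simp_rw [ENNReal.mul_rpow_of_nonneg _ _ hq]
    rw [lintegral_const_mul'' _ (by fun_prop)]
    gcongr
  filter_upwards [hB.cont, hB.toIsPreBrownianReal.eval_zero_ae_eq_zero, hBH, hMB]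
    with ω hc h0 hBHω ⟨hM1, hMω⟩
  have hsup : supNorm T (fun t => approx H T (B · ω) ε t - BH t ω) =
      supNorm T (fun t => approx H T (B · ω) ε t - Lam H (B · ω) t) :=
    iSup_congr fun t => iSup_congr fun ht => by simp only [hBHω t ht]
  have hdet := hpath (M ω) (B · ω) hM1 hc h0 hMω ε hε
  rw [hsup]
  constructor
  · refine (hdet 1 zero_le_one fun t ht => ?_).trans_eq ?_
    · have : (t : ℝ) ≤ T := ht
      linarith [(lastTime (B · ω) ε t).coe_nonneg, T.coe_nonneg]
    · rw [Real.one_rpow, ENNReal.ofReal_max, ENNReal.ofReal_one]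
  · intro hωA
    refine (hdet _ (by positivity) (hgap ω hωA hc)).trans_eq ?_
    rw [← Real.rpow_mul hε.le, div_mul_cancel₀ _ hγH0.ne', max_self]

lemma exists_sqrt_mul_add_sqrt_le {F : ℝ≥0∞} (hF : F ≠ ∞) (S α : ℝ) {p : ℝ} (hp : 0 < p) :
    ∃ C : ℝ, 0 < C ∧ ∀ ε > 0, ∀ a ≤ ENNReal.ofReal (S * ε ^ (2 * α)),
      F ^ (1 / 2 : ℝ) * (ENNReal.ofReal (ε ^ (α / p)) ^ p + a ^ (1 / 2 : ℝ)) ≤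
        ENNReal.ofReal (C * ε ^ α) := by
  set C := F ^ (1 / 2 : ℝ) * (1 + ENNReal.ofReal S ^ (1 / 2 : ℝ))
  have hC : C ≠ ∞ := by finiteness
  refine ⟨C.toReal + 1, by positivity, fun ε hε a ha => ?_⟩
  have hmain : ENNReal.ofReal (ε ^ (α / p)) ^ p = ENNReal.ofReal (ε ^ α) := by
    rw [ENNReal.ofReal_rpow_of_nonneg (by positivity) hp.le, ← Real.rpow_mul hε.le,
      div_mul_cancel₀ _ hp.ne']
  have hsqrt : a ^ (1 / 2 : ℝ) ≤ ENNReal.ofReal S ^ (1 / 2 : ℝ) * ENNReal.ofReal (ε ^ α) := by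
    refine (ENNReal.rpow_le_rpow ha (by norm_num)).trans_eq ?_
    rw [ENNReal.ofReal_mul' (by positivity), ENNReal.mul_rpow_of_nonneg _ _ (by norm_num),
      ENNReal.ofReal_rpow_of_nonneg (p := 1 / 2) (x := ε ^ (2 * α)) (by positivity) (by norm_num),
      ← Real.rpow_mul hε.le, mul_one_div, mul_div_cancel_left₀ _ two_ne_zero]
  calc F ^ (1 / 2 : ℝ) * (ENNReal.ofReal (ε ^ (α / p)) ^ p + a ^ (1 / 2 : ℝ)) ≤
        F ^ (1 / 2 : ℝ) * (ENNReal.ofReal (ε ^ α) +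
          ENNReal.ofReal S ^ (1 / 2 : ℝ) * ENNReal.ofReal (ε ^ α)) := by
        rw [hmain]
        gcongr
    _ = C * ENNReal.ofReal (ε ^ α) := by simp only [C]; ring
    _ ≤ ENNReal.ofReal ((C.toReal + 1) * ε ^ α) := by
        rw [ENNReal.ofReal_mul (by positivity)]
        gcongr
        exact (ENNReal.ofReal_toReal hC).symm.trans_le (ENNReal.ofReal_le_ofReal (by linarith))

lemma rate_mem_Ioo {H p δ lam : ℝ} (hp : 0 < p) (hδ1 : δ < 1) (hlam0 : (1 - H) / 2 < lam)
    (hlam1 : lam < 1 / 2 + (2 * δ - 2) / (2 * p)) :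
    p * (1 - 2 * lam) + 2 * (δ - 1) ∈ Set.Ioo 0 (p * H) := by
  constructor
  · have h := mul_lt_mul_of_pos_left hlam1 (show 0 < 2 * p by positivity)
    rw [mul_add, mul_div_cancel₀ _ (by positivity)] at h
    linarith
  · have h := mul_lt_mul_of_pos_left hlam0 hp
    linarith

end KnightFBM

theorem theorem3p1_general {H p α : ℝ} {T : ℝ≥0} (hH0 : 0 < H) (hH : H < 1 / 2) (hT : 0 < T)
    (hα0 : 0 < α) (hα : α < p * H) :
    ∃ C : ℝ, 0 < C ∧
      ∀ (Ω : Type*) [MeasurableSpace Ω] (P : Measure Ω) [IsProbabilityMeasure P]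
        (B BH : ℝ≥0 → Ω → ℝ), IsBrownianReal B P →
        (∀ᵐ ω ∂P, ∀ t ≤ T, BH t ω = KnightFBM.Lam H (fun s => B s ω) t) →
        ∀ ε > 0, ∫⁻ ω, KnightFBM.supNorm T
            (fun t => KnightFBM.approx H T (fun s => B s ω) ε t - BH t ω) ^ p ∂P ≤
          ENNReal.ofReal (C * ε ^ α) := by
  have hp : 0 < p := pos_of_mul_pos_left (hα0.trans hα) hH0.le
  obtain ⟨F, hF, S, hFS⟩ := KnightFBM.exists_supNorm_approx_sub_le_of_isBrownianReal hH0 hH hT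
    (div_nonneg hα0.le hp.le) ((div_lt_iff₀' hp).2 hα) (q := 2 * p) (by positivity) (2 * α)
  obtain ⟨C, hC0, hC⟩ := KnightFBM.exists_sqrt_mul_add_sqrt_le hF S α hp
  refine ⟨C, hC0, fun Ω _ P _ B BH hB hBH ε hε => ?_⟩
  obtain ⟨Y, A, hY, hYF, hA, hX⟩ := hFS Ω P B BH hB hBH ε hε
  refine (KnightFBM.lintegral_rpow_le_of_exceptional hY hp.le (hX.mono fun _ h => h.1)
    (hX.mono fun _ h => h.2)).trans (le_trans ?_ (hC ε hε _ hA))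
  gcongr

/-- `B` is a standard Brownian motion and `BH` is the fractional Brownian motion that it realizes,
`BH = Λ_H B` on `[0, T]` almost surely. The constant depends only on `p, δ, H, T, lam`. -/
theorem theorem3p1 (H p δ lam : ℝ) (T : ℝ≥0) (hH0 : 0 < H) (hH : H < 1 / 2) (hp : 1 ≤ p)
    (hT : 0 < T) (hδ0 : max 0 (1 - p * H / 2) < δ) (hδ1 : δ < 1)
    (hlam0 : (1 - H) / 2 < lam) (hlam1 : lam < 1 / 2 + (2 * δ - 2) / (2 * p)) :
    ∃ C : ℝ, 0 < C ∧
      ∀ (Ω : Type*) [MeasurableSpace Ω] (P : Measure Ω) [IsProbabilityMeasure P]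
        (B BH : ℝ≥0 → Ω → ℝ), IsBrownianReal B P →
        (∀ᵐ ω ∂P, ∀ t ≤ T, BH t ω = KnightFBM.Lam H (fun s => B s ω) t) →
        ∀ ε : ℕ → ℝ, (∀ k, 0 < ε k) → Antitone ε → Tendsto ε atTop (𝓝 0) →
        ∀ k, ∫⁻ ω, KnightFBM.supNorm T
              (fun t => KnightFBM.approx H T (fun s => B s ω) (ε k) t - BH t ω) ^ p ∂P
            ≤ ENNReal.ofReal (C * ε k ^ (p * (1 - 2 * lam) + 2 * (δ - 1))) := by
  obtain ⟨hα0, hα⟩ := KnightFBM.rate_mem_Ioo (zero_lt_one.trans_le hp) hδ1 hlam0 hlam1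
  obtain ⟨C, hC0, hC⟩ := theorem3p1_general hH0 hH hT hα0 hα
  exact ⟨C, hC0, fun Ω _ P _ B BH hB hBH ε hε _ _ k => hC Ω P B BH hB hBH (ε k) (hε k)⟩
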